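/- **Setting.** Let $N$ be the number of particles, $d$ the dimension, $0\le\mathcal W\in L^1_{\mathrm{loc}}(\mathbb R^{dN})$, and let $\mathcal K_0=-\sum_{j=1}^N\kappa_j\Delta_j+\mathcal W$ be defined as a form sum on $L^2(\mathbb R^{dN})$; put $T=\mathcal K_0+1$. Let $\omega$ be a positive self-adjoint operator with trivial kernel on a separable complex Hilbert space $\mathfrak h$, and let $\mathfrak h_\omega$ be the completion of $\bigcap_k\mathcal D(\omega^k)$ for $\langle\cdot|\omega|\cdot\rangle$. For $z\in\mathfrak h_\omega$ let $\mathcal H_z$ be, as a quadratic form on the form domain of $\mathcal K_0$, one of the following. * (Nelson) $\mathcal H_z=\mathcal K_0+\sum_j 2\,\mathrm{Re}\langle z|\lambda(x_j)\rangle+\langle z|\omega|z\rangle$, with $\kappa_j=1$, $d\in\{1,2,3\}$ and $\lambda,\omega^{-1/2}\lambda\in L^\infty(\mathbb R^d;\mathfrak h)$. * (Fröhlich polaron) $\mathfrak h=L^2(\mathbb R^d)$, $d\in\{1,2,3\}$, $\omega=1$, $\kappa_j=1$ and $\mathcal H_z=\mathcal K_0+\sum_j\mathcal V_z(x_j)+\|z\|^2$,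 where $\mathcal V_z(x)=2\sqrt\alpha\,\mathrm{Re}\int \overline{z(k)}\,e^{-ik\cdot x}|k|^{-(d-1)/2}dk$ with $\alpha>0$. Here the part $|k|\le r$ (for a fixed $r>0$) is a bounded function, and the part $|k|>r$ is the divergence of a bounded vector field $c$, read as the form of the commutator $[\nabla,c]$. * (Pauli–Fierz) $d=3$, $\kappa_j=\frac1{2m_j}$ with $m_j>0$, and $\mathcal H_z=\sum_j\frac1{2m_j}\bigl(-i\nabla_j+e\,a_{z,j}(x_j)\bigr)^2+\mathcal W+\langle z|\omega|z\rangle$, where $e\in\mathbb R$, $a_{z,j,\ell}(x)=2\,\mathrm{Re}\langle z|\lambda_{j\ell}(x)\rangle$ and $\lambda_{j\ell},\omega^{-1/2}\lambda_{j\ell}\in L^\infty(\mathbb R^3;\mathfrak h)$. **Generalized states and measures.** A positive generalized state is a positive element of the weak-$*$ closure of the trace class operators in the dual of the bounded operators $\mathcal B(L^2(\mathbb R^{dN}))$. A generalized state is one of norm $1$, and it is pure if it is an extreme point of the set of generalized states. A generalized state-valued measure $\mathfrak n$ is a norm-countably additive measure on the Borel sets of $\mathfrak h_\omega$ with values in the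 positive generalized states; it is a probability measure if $\|\mathfrak n(\mathfrak h_\omega)\|=1$. Its norm measure is $m(S)=\|\mathfrak n(S)\|$, and $\int d\mathfrak n(z)[F(z)]$ is the continuous extension of $\sum_j\mathfrak n(S_j)[c_j]$ from simple functions to operator-valued functions $F$ that are Bochner integrable for $m$. A generalized state $\varrho$ (respectively, measure $\mathfrak n$) is in the domain of $T$ if there is a positive generalized state $\varrho_T$ (respectively, a generalized state-valued measure $\mathfrak n_T$, not necessarily normalized) with $\varrho_T[T^{-1/2}BT^{-1/2}]=\varrho[B]$ (respectively, $\mathfrak n_T(S)[T^{-1/2}BT^{-1/2}]=\mathfrak n(S)[B]$ for every Borel set $S$) for every bounded $B$. The energies are then $$\mathcal E_{\mathrm{gqc}}[\varrho,z]=\varrho_T\bigl[T^{-1/2}\mathcal H_zT^{-1/2}\bigr],\qquad \int d\mathfrak n(z)[\mathcal H_z]=\int d\mathfrak n_T(z)\bigl[T^{-1/2}\mathcal H_zT^{-1/2}\bigr],$$ the second one whenever the integrand is Bochner integrable for the norm measure of $\mathfrak n_T$. The first energy is to be minimized over the generalized states (or only over the pure ones) $\varrho$ in the domain of $T$ and over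 $z\in\mathfrak h_\omega$; the second over the generalized state-valued probability measures in the domain of $T$ with integrable integrand. **Proposition.** In each of the three models: 1. $\mathcal E_{\mathrm{gqc}}$ has a minimizer $(\varrho,z)$ with $\varrho$ a generalized state if and only if $\int d\mathfrak n(z)[\mathcal H_z]$ has a minimizer; and $\mathcal E_{\mathrm{gqc}}$ restricted to pure generalized states has a minimizer if and only if $\int d\mathfrak n(z)[\mathcal H_z]$ has one. 2. Every minimizing measure $\mathfrak n$ is concentrated on minimizers of $\mathcal E_{\mathrm{gqc}}$. That is, there are generalized states $\varrho_z$ with $\mathfrak n(S)[B]=\int_S\varrho_z[B]\,dm(z)$ for all Borel sets $S$ and all bounded $B$; and, for every such family and for $m$-almost every $z$, $(\varrho_z,z)$ is a minimizer of $\mathcal E_{\mathrm{gqc}}$ and $\varrho_z$ lies in the weak-$*$ closed convex hull of the pure generalized states $\sigma$ such that $(\sigma,z)$ minimizes $\mathcal E_{\mathrm{gqc}}$ among pure generalized states. -/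

import Mathlib

noncomputable section

open MeasureTheory Filter Topology
open scoped ComplexOrder InnerProductSpace ENNReal

namespace QuasiClassical

/-! ## Generalized states -/

section States

variable (H : Type*) [NormedAddCommGroup H] [InnerProductSpace ℂ H] [CompleteSpace H]

/-- Bounded operators on `H`. -/
abbrev BOp : Type _ := H →L[ℂ] H

/-- The functionals `B ↦ tr (Γ B)` with `Γ = ∑ₙ |yₙ⟩⟨xₙ|` trace class, inside the dual of the
bounded operators with its weak-* topology. -/
def traceClassFunctionals : Set (WeakDual ℂ (BOp H)) :=
  {F | ∃ x y : ℕ → H, Summable (fun n => ‖x n‖ ^ 2) ∧ Summable (fun n => ‖y n‖ ^ 2) ∧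
    ∀ B : BOp H, F B = ∑' n, inner ℂ (x n) (B (y n))}

/-- Positive elements of the weak-* closure of the trace class operators. -/
def genPositive : Set (StrongDual ℂ (BOp H)) :=
  {ρ | StrongDual.toWeakDual ρ ∈ closure (traceClassFunctionals H) ∧
    ∀ B : BOp H, 0 ≤ B → 0 ≤ ρ B}

/-- Normalized generalized states. -/
def genStates : Set (StrongDual ℂ (BOp H)) := {ρ | ρ ∈ genPositive H ∧ ‖ρ‖ = 1}

/-- Pure generalized states: the extreme points of the set of normalized generalized states. -/
def genPureStates : Set (StrongDual ℂ (BOp H)) := (genStates H).extremePoints ℝ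

variable {H}

/-- The norm of a positive functional is its value at the identity. -/
theorem norm_eq_of_positive {ρ : StrongDual ℂ (BOp H)} (h : ∀ B : BOp H, 0 ≤ B → 0 ≤ ρ B) :
    ((‖ρ‖ : ℝ) : ℂ) = ρ 1 := by
  have h1 : 0 ≤ ρ 1 := h 1 zero_le_one
  have him : (ρ 1).im = 0 := ((Complex.nonneg_iff.mp h1).2).symm
  have hre : 0 ≤ (ρ 1).re := (Complex.nonneg_iff.mp h1).1
  have hsa : ∀ A : BOp H, IsSelfAdjoint A → (ρ A).im = 0 ∧ (ρ A).re ≤ ‖A‖ * (ρ 1).re := by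
    intro A hA
    have h2 : 0 ≤ ρ (algebraMap ℝ (BOp H) ‖A‖ - A) :=
      h _ (sub_nonneg.mpr hA.le_algebraMap_norm_self)
    have h3 : ρ (algebraMap ℝ (BOp H) ‖A‖ - A) = (‖A‖ : ℂ) * ρ 1 - ρ A := by
      rw [map_sub, Algebra.algebraMap_eq_smul_one, ← Complex.coe_smul, map_smul, smul_eq_mul]
    rw [h3, Complex.nonneg_iff] at h2
    obtain ⟨h4, h5⟩ := h2
    simp [him] at h4 h5
    exact ⟨h5, h4⟩
  have key : ‖ρ‖ = (ρ 1).re := by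
    apply le_antisymm
    · refine ContinuousLinearMap.opNorm_le_bound _ hre fun B => ?_
      obtain ⟨c, hc, hcB⟩ : ∃ c : ℂ, ‖c‖ = 1 ∧ c * ρ B = (‖ρ B‖ : ℂ) := by
        by_cases hB : ρ B = 0
        · exact ⟨1, by simp, by simp [hB]⟩
        · refine ⟨(‖ρ B‖ : ℂ) / ρ B, ?_, div_mul_cancel₀ _ hB⟩
          simp [hB]
      have h6 := hsa _ (realPart (c • B)).2
      have h7 := hsa _ (imaginaryPart (c • B)).2
      have h8 : ρ (c • B) = ρ (realPart (c • B) : BOp H)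
          + Complex.I * ρ (imaginaryPart (c • B) : BOp H) := by
        conv_lhs => rw [← realPart_add_I_smul_imaginaryPart (c • B)]
        rw [map_add, ρ.map_smul Complex.I, smul_eq_mul]
      rw [map_smul, smul_eq_mul, hcB] at h8
      have h9 := congrArg Complex.re h8
      simp only [Complex.ofReal_re, Complex.add_re, Complex.mul_re, Complex.I_re, zero_mul,
        Complex.I_im, one_mul, h7.1, sub_zero, add_zero] at h9
      rw [h9, mul_comm]
      refine h6.2.trans (mul_le_mul_of_nonneg_right ?_ hre)
      refine (realPart.norm_le (c • B)).trans ?_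
      rw [norm_smul, hc, one_mul]
    · have h10 : ‖ρ 1‖ ≤ ‖ρ‖ * ‖(1 : BOp H)‖ := ρ.le_opNorm 1
      have h11 : (ρ 1).re ≤ ‖ρ 1‖ := Complex.re_le_norm _
      have h12 : ‖(1 : BOp H)‖ ≤ 1 := ContinuousLinearMap.norm_id_le
      nlinarith [norm_nonneg ρ]
  rw [key]
  exact Complex.ext (by simp) (by simp [him])

end States

/-! ## Generalized state-valued measures and integration -/

section Measures

variable (X : Type*) [MeasurableSpace X] (H : Type*) [NormedAddCommGroup H]
  [InnerProductSpace ℂ H] [CompleteSpace H]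

/-- A generalized state-valued measure: a countably additive measure (unconditionally in the norm
of the dual of the bounded operators) with values in the positive generalized states. -/
structure GenMeasure where
  /-- the underlying vector measure -/
  vm : VectorMeasure X (StrongDual ℂ (BOp H))
  mem_genPositive : ∀ S, MeasurableSet S → vm S ∈ genPositive H

variable {X H}

namespace GenMeasure

theorem norm_apply_eq (n : GenMeasure X H) {S : Set X} (hS : MeasurableSet S) :
    ‖n.vm S‖ = (n.vm S 1).re := by
  rw [← norm_eq_of_positive (n.mem_genPositive S hS).2, Complex.ofReal_re]

/-- The scalar norm measure `S ↦ ‖n S‖`. -/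
def normMeasure (n : GenMeasure X H) : Measure X :=
  Measure.ofMeasurable (fun S _ => ENNReal.ofReal ‖n.vm S‖) (by simp) (by
    intro f hf hd
    have h1 := (n.vm.m_iUnion hf hd)
    have h2 : HasSum (fun i => (n.vm (f i) 1).re) (n.vm (⋃ i, f i) 1).re := by
      have h3 := h1.mapL (ContinuousLinearMap.apply ℂ ℂ (1 : BOp H))
      exact Complex.reCLM.hasSum h3
    have h4 : ∀ i, 0 ≤ (n.vm (f i) 1).re := fun i => by
      rw [← n.norm_apply_eq (hf i)]; exact norm_nonneg _
    simp only [n.norm_apply_eq (MeasurableSet.iUnion hf), n.norm_apply_eq (hf _)]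
    rw [← h2.tsum_eq, ENNReal.ofReal_tsum_of_nonneg h4 h2.summable])

theorem normMeasure_apply (n : GenMeasure X H) {S : Set X} (hS : MeasurableSet S) :
    n.normMeasure S = ENNReal.ofReal ‖n.vm S‖ :=
  Measure.ofMeasurable_apply S hS

/-- The set function `S ↦ (B ↦ n(S)[B])`, over the reals. -/
def setFun (n : GenMeasure X H) (S : Set X) : BOp H →L[ℝ] ℂ := (n.vm S).restrictScalars ℝ

theorem dominated (n : GenMeasure X H) :
    DominatedFinMeasAdditive n.normMeasure n.setFun 1 := by
  refine ⟨fun s t hs ht _ _ hd => ?_, fun s hs _ => ?_⟩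
  · ext B
    simp [setFun, n.vm.of_union hd hs ht]
  · rw [one_mul, Measure.real, n.normMeasure_apply hs, ENNReal.toReal_ofReal (norm_nonneg _)]
    exact le_of_eq (ContinuousLinearMap.norm_restrictScalars _)

/-- The integral `∫ dn(z)[F(z)]` of an operator-valued function: the continuous extension of
`∑ⱼ n(Sⱼ)[cⱼ]` from simple functions to functions that are absolutely integrable, i.e. Bochner
integrable for the norm measure. -/
def integral (n : GenMeasure X H) (F : X → BOp H) : ℂ :=
  setToFun n.normMeasure n.setFun n.dominated F

end GenMeasure

end Measures

/-! ## The generalized variational problems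

`Q` is the form domain of `T = 𝒦₀ + 1`, a Hilbert space for the form of `T`, and `J : Q → H` is
the inclusion.  The form of `ℋ_z` is given on `Q` for every classical configuration `z : X`. -/

section Variational

variable {H : Type*} [NormedAddCommGroup H] [InnerProductSpace ℂ H] [CompleteSpace H]
  {Q : Type*} [NormedAddCommGroup Q] [InnerProductSpace ℂ Q] [CompleteSpace Q]
  {X : Type*} [MeasurableSpace X]

/-- `T⁻¹ = J J†`: the vector `u = J† f` is the solution in `Q` of `⟪v, u⟫_Q = ⟪J v, f⟫` for all
`v : Q`, where `⟪·, ·⟫_Q` is the closed form of `T`. -/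
def invT (J : Q →L[ℂ] H) : BOp H := J ∘L ContinuousLinearMap.adjoint J

/-- `T^{-1/2}`. -/
def invSqrtT (J : Q →L[ℂ] H) : BOp H := CFC.sqrt (invT J)

/-- `A = T^{-1/2} 𝓕 T^{-1/2}` for the operator `𝓕` with form `a` on `Q`:
`⟪f, A g⟫ = a(T^{-1/2} f, T^{-1/2} g)` for all `f, g`. -/
def IsSandwich (J : Q →L[ℂ] H) (a : Q → Q → ℂ) (A : BOp H) : Prop :=
  ∀ (f g : H) (u v : Q), J u = invSqrtT J f → J v = invSqrtT J g → inner ℂ f (A g) = a u v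

/-- `e` is the value `ρ[ℋ_z] = ρ_T[T^{-1/2} ℋ_z T^{-1/2}]`, where `ρ_T` is a positive generalized
state with `ρ_T[T^{-1/2} B T^{-1/2}] = ρ[B]`; in particular `ρ` is in the domain of `T`. -/
def IsGqcEnergy (J : Q →L[ℂ] H) (a : X → Q → Q → ℂ) (ρ : StrongDual ℂ (BOp H)) (z : X)
    (e : ℝ) : Prop :=
  ∃ ρT ∈ genPositive H, (∀ B : BOp H, ρT (invSqrtT J * B * invSqrtT J) = ρ B) ∧
    ∃ A : BOp H, IsSandwich J (a z) A ∧ ρT A = (e : ℂ)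

/-- The infimum of the energy `ρ[ℋ_z]` over `z` and over the states `ρ` in the class `𝒮`. -/
def gqcInf (J : Q →L[ℂ] H) (a : X → Q → Q → ℂ) (𝒮 : Set (StrongDual ℂ (BOp H))) : EReal :=
  sInf {E : EReal | ∃ ρ ∈ 𝒮, ∃ (z : X) (e : ℝ), IsGqcEnergy J a ρ z e ∧ E = (e : EReal)}

/-- `(ρ, z)` minimizes the energy `ρ[ℋ_z]` over the states `ρ` in the class `𝒮` and over `z`. -/
def IsGqcMinimizer (J : Q →L[ℂ] H) (a : X → Q → Q → ℂ) (𝒮 : Set (StrongDual ℂ (BOp H)))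
    (ρ : StrongDual ℂ (BOp H)) (z : X) : Prop :=
  ρ ∈ 𝒮 ∧ ∃ e : ℝ, IsGqcEnergy J a ρ z e ∧ (e : EReal) = gqcInf J a 𝒮

/-- `nT` exhibits `n` as a measure in the domain of `T`. -/
def IsLift (J : Q →L[ℂ] H) (n nT : GenMeasure X H) : Prop :=
  ∀ S, MeasurableSet S → ∀ B : BOp H, nT.vm S (invSqrtT J * B * invSqrtT J) = n.vm S B

/-- `e` is the value `∫ dn(z)[ℋ_z] = ∫ dn_T(z)[T^{-1/2} ℋ_z T^{-1/2}]`; in particular `n` is in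
the domain of `T` and the integrand is absolutely integrable. -/
def IsGsvmEnergy (J : Q →L[ℂ] H) (a : X → Q → Q → ℂ) (n : GenMeasure X H) (e : ℝ) : Prop :=
  ∃ nT : GenMeasure X H, IsLift J n nT ∧
    ∃ A : X → BOp H, (∀ z, IsSandwich J (a z) (A z)) ∧ Integrable A nT.normMeasure ∧
      nT.integral A = (e : ℂ)

/-- The infimum of `∫ dn(z)[ℋ_z]` over the generalized state-valued probability measures. -/
def gsvmInf (J : Q →L[ℂ] H) (a : X → Q → Q → ℂ) : EReal :=
  sInf {E : EReal | ∃ n : GenMeasure X H, ‖n.vm Set.univ‖ = 1 ∧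
    ∃ e : ℝ, IsGsvmEnergy J a n e ∧ E = (e : EReal)}

/-- `n` minimizes `∫ dn(z)[ℋ_z]` over the generalized state-valued probability measures. -/
def IsGsvmMinimizer (J : Q →L[ℂ] H) (a : X → Q → Q → ℂ) (n : GenMeasure X H) : Prop :=
  ‖n.vm Set.univ‖ = 1 ∧ ∃ e : ℝ, IsGsvmEnergy J a n e ∧ (e : EReal) = gsvmInf J a

/-- `dn(z) = ρ_z dm(z)` in the weak-* sense, where `m` is the norm measure of `n` and the `ρ_z`
are normalized generalized states. -/
def IsWeakDensity (n : GenMeasure X H) (ρ : X → StrongDual ℂ (BOp H)) : Prop :=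
  (∀ᵐ z ∂n.normMeasure, ρ z ∈ genStates H) ∧
    ∀ B : BOp H, Integrable (fun z => ρ z B) n.normMeasure ∧
      ∀ S, MeasurableSet S → n.vm S B = ∫ z in S, ρ z B ∂n.normMeasure

/-- `n` is concentrated on the minimizers of the energy `ρ[ℋ_z]`: it has a weak-* density
`dn(z) = ρ_z dm(z)`, and for every such density and almost every `z`, the pair `(ρ_z, z)` is a
minimizer and `ρ_z` is a (possibly infinite) convex combination of pure states `σ` such that
`(σ, z)` is a minimizer among the pure states, i.e. belongs to their weak-* closed convex hull. -/
def IsConcentrated (J : Q →L[ℂ] H) (a : X → Q → Q → ℂ) (n : GenMeasure X H) : Prop :=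
  (∃ ρ, IsWeakDensity n ρ) ∧
    ∀ ρ, IsWeakDensity n ρ → ∀ᵐ z ∂n.normMeasure,
      IsGqcMinimizer J a (genStates H) (ρ z) z ∧
      StrongDual.toWeakDual (ρ z) ∈
        closure (convexHull ℝ (StrongDual.toWeakDual ''
          {σ : StrongDual ℂ (BOp H) | IsGqcMinimizer J a (genPureStates H) σ z}))

/-- The energy `ρ[ℋ_z]` has a minimizer (among all, equivalently among pure generalized states) if
and only if `∫ dn(z)[ℋ_z]` has one, and every minimizing measure is concentrated on minimizers. -/
def MinimizerEquivalence (J : Q →L[ℂ] H) (a : X → Q → Q → ℂ) : Prop :=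
  ((∃ ρ z, IsGqcMinimizer J a (genStates H) ρ z) ↔
      ∃ n : GenMeasure X H, IsGsvmMinimizer J a n) ∧
  ((∃ ρ z, IsGqcMinimizer J a (genPureStates H) ρ z) ↔
      ∃ n : GenMeasure X H, IsGsvmMinimizer J a n) ∧
  ∀ n : GenMeasure X H, IsGsvmMinimizer J a n → IsConcentrated J a n

end Variational

/-! ## The particles: `𝒦₀ = -∑ⱼ κⱼ Δⱼ + 𝒲` on `L²(ℝ^{dN})` -/

section Particles

/-- The configuration space `ℝ^{dN}`. -/
abbrev Cfg (N d : ℕ) : Type := EuclideanSpace ℝ (Fin N × Fin d)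

/-- The position `x_j` of the `j`-th particle. -/
def pos {N d : ℕ} (x : Cfg N d) (j : Fin N) : EuclideanSpace ℝ (Fin d) :=
  WithLp.toLp 2 fun i => x (j, i)

/-- `L²(ℝ^{dN})`. -/
abbrev L2 (N d : ℕ) : Type := Lp ℂ 2 (volume : Measure (Cfg N d))

/-- `g` is the weak partial derivative of `f` in the direction of the coordinate `p`. -/
def IsWeakDeriv {N d : ℕ} (p : Fin N × Fin d) (f g : L2 N d) : Prop :=
  ∀ φ : Cfg N d → ℝ, ContDiff ℝ ((⊤ : ℕ∞) : WithTop ℕ∞) φ → HasCompactSupport φ →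
    ∫ x, ((fderiv ℝ φ x (EuclideanSpace.single p 1) : ℝ) : ℂ) * f x = -∫ x, (φ x : ℂ) * g x

theorem exists_pairing {N d : ℕ} {φ : Cfg N d → ℝ} (hφ : Continuous φ)
    (hc : HasCompactSupport φ) :
    ∃ ℓ : L2 N d →L[ℂ] ℂ, ∀ f, ∫ x, (φ x : ℂ) * f x = ℓ f := by
  have h1 : Continuous fun x => (φ x : ℂ) := Complex.continuous_ofReal.comp hφ
  have h2 : HasCompactSupport fun x => (φ x : ℂ) := hc.comp_left (g := fun t : ℝ => (t : ℂ)) rfl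
  have h3 : MemLp (fun x => (φ x : ℂ)) 2 (volume : Measure (Cfg N d)) :=
    h1.memLp_of_hasCompactSupport h2
  refine ⟨innerSL ℂ (h3.toLp _), fun f => ?_⟩
  rw [innerSL_apply_apply, L2.inner_def]
  refine integral_congr_ae ?_
  filter_upwards [h3.coeFn_toLp] with x hx
  rw [hx, RCLike.inner_apply]
  simp [mul_comm]

theorem isWeakDeriv_iff {N d : ℕ} (p : Fin N × Fin d) :
    ∃ 𝓛 : Set ((L2 N d →L[ℂ] ℂ) × (L2 N d →L[ℂ] ℂ)), ∀ f g : L2 N d,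
      IsWeakDeriv p f g ↔ ∀ ℓ ∈ 𝓛, ℓ.1 f = -ℓ.2 g := by
  refine ⟨{ℓ | ∃ φ : Cfg N d → ℝ, ContDiff ℝ ((⊤ : ℕ∞) : WithTop ℕ∞) φ ∧ HasCompactSupport φ ∧
    (∀ f : L2 N d, ∫ x, ((fderiv ℝ φ x (EuclideanSpace.single p 1) : ℝ) : ℂ) * f x = ℓ.1 f) ∧
    ∀ g : L2 N d, ∫ x, (φ x : ℂ) * g x = ℓ.2 g}, fun f g => ⟨?_, ?_⟩⟩
  · rintro h ⟨ℓ₁, ℓ₂⟩ ⟨φ, h1, h2, h3, h4⟩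
    rw [← h3, ← h4]
    exact h φ h1 h2
  · intro h φ h1 h2
    obtain ⟨ℓ₁, h3⟩ := exists_pairing (N := N) (d := d)
      (φ := fun x => fderiv ℝ φ x (EuclideanSpace.single p 1))
      ((h1.continuous_fderiv (by simp)).clm_apply continuous_const) (h2.fderiv_apply ℝ _)
    obtain ⟨ℓ₂, h4⟩ := exists_pairing h1.continuous h2
    rw [h3, h4]
    exact h (ℓ₁, ℓ₂) ⟨φ, h1, h2, h3, h4⟩

/-- Pairs `(f, g)` with `g = √W f` almost everywhere. -/
def IsSqrtMul {N d : ℕ} (W : Cfg N d → ℝ) (f g : L2 N d) : Prop :=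
  ∀ᵐ x, g x = (√(W x) : ℂ) * f x

/-- Index set for the components of an element of the form domain. -/
inductive Comp (N d : ℕ) : Type
  /-- `ψ` -/
  | state : Comp N d
  /-- `√𝒲 ψ` -/
  | pot : Comp N d
  /-- `√κⱼ ∂_{j,i} ψ` -/
  | grad : Fin N × Fin d → Comp N d
  deriving DecidableEq, Fintype

/-- The form domain of `T = 𝒦₀ + 1`, as the subspace of all `(ψ, √𝒲 ψ, (√κⱼ ∂_{j,i} ψ))` in a
Hilbert sum of copies of `L²`; its inner product is the form of `T`. -/
def formSubmodule {N d : ℕ} (κ : Fin N → ℝ) (W : Cfg N d → ℝ) :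
    Submodule ℂ (PiLp 2 fun _ : Comp N d => L2 N d) where
  carrier := {u | IsSqrtMul W (u .state) (u .pot) ∧
    ∀ p, IsWeakDeriv p (((√(κ p.1) : ℝ) : ℂ) • u .state) (u (.grad p))}
  add_mem' := by
    rintro u v ⟨hu, hu'⟩ ⟨hv, hv'⟩
    refine ⟨?_, fun p => ?_⟩
    · filter_upwards [hu, hv, Lp.coeFn_add (u .state) (v .state), Lp.coeFn_add (u .pot) (v .pot)]
        with x h1 h2 h3 h4
      simp only [PiLp.add_apply]
      rw [h3, h4, Pi.add_apply, Pi.add_apply, h1, h2, mul_add]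
    · obtain ⟨𝓛, h𝓛⟩ := isWeakDeriv_iff (N := N) (d := d) p
      rw [h𝓛]
      intro ℓ hℓ
      have h1 := (h𝓛 _ _).mp (hu' p) ℓ hℓ
      have h2 := (h𝓛 _ _).mp (hv' p) ℓ hℓ
      simp only [PiLp.add_apply, smul_add, map_add, h1, h2]
      ring
  zero_mem' := by
    refine ⟨?_, fun p => ?_⟩
    · filter_upwards [Lp.coeFn_zero ℂ 2 (volume : Measure (Cfg N d))] with x h1
      simp only [PiLp.zero_apply]
      rw [h1]; simp
    · obtain ⟨𝓛, h𝓛⟩ := isWeakDeriv_iff (N := N) (d := d) p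
      rw [h𝓛]
      intro ℓ hℓ
      simp
  smul_mem' := by
    rintro c u ⟨hu, hu'⟩
    refine ⟨?_, fun p => ?_⟩
    · filter_upwards [hu, Lp.coeFn_smul c (u .state), Lp.coeFn_smul c (u .pot)] with x h1 h3 h4
      simp only [PiLp.smul_apply]
      rw [h3, h4, Pi.smul_apply, Pi.smul_apply, h1, smul_eq_mul, smul_eq_mul]
      ring
    · obtain ⟨𝓛, h𝓛⟩ := isWeakDeriv_iff (N := N) (d := d) p
      rw [h𝓛]
      intro ℓ hℓ
      have h1 := (h𝓛 _ _).mp (hu' p) ℓ hℓ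
      simp only [PiLp.smul_apply]
      rw [smul_comm, map_smul, h1, map_smul, smul_neg]

theorem isClosed_formSubmodule {N d : ℕ} (κ : Fin N → ℝ) (W : Cfg N d → ℝ) :
    IsClosed (formSubmodule κ W : Set (PiLp 2 fun _ : Comp N d => L2 N d)) := by
  have hcont : ∀ i : Comp N d, Continuous fun u : PiLp 2 (fun _ : Comp N d => L2 N d) => u i :=
    fun i => PiLp.continuous_apply 2 _ i
  have h1 : IsClosed {u : PiLp 2 (fun _ : Comp N d => L2 N d) |
      IsSqrtMul W (u .state) (u .pot)} := by
    refine IsSeqClosed.isClosed fun u u₀ hu hlim => ?_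
    have hs := ((hcont .state).tendsto u₀).comp hlim
    have hp := ((hcont .pot).tendsto u₀).comp hlim
    obtain ⟨ns, hns, hs'⟩ := (tendstoInMeasure_of_tendsto_Lp hs).exists_seq_tendsto_ae
    have hp' := hp.comp hns.tendsto_atTop
    obtain ⟨ms, hms, hp''⟩ := (tendstoInMeasure_of_tendsto_Lp hp').exists_seq_tendsto_ae
    have hall : ∀ᵐ x, ∀ k, u k .pot x = (√(W x) : ℂ) * u k .state x := ae_all_iff.mpr hu
    filter_upwards [hs', hp'', hall] with x ha hb hc
    refine tendsto_nhds_unique hb ?_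
    have := (ha.comp hms.tendsto_atTop).const_mul (√(W x) : ℂ)
    refine this.congr fun k => ?_
    simp only [Function.comp_apply]
    rw [hc]
  have h2 : ∀ p, IsClosed {u : PiLp 2 (fun _ : Comp N d => L2 N d) |
      IsWeakDeriv p (((√(κ p.1) : ℝ) : ℂ) • u .state) (u (.grad p))} := by
    intro p
    obtain ⟨𝓛, h𝓛⟩ := isWeakDeriv_iff (N := N) (d := d) p
    simp only [h𝓛, Set.ofPred_forall]
    refine isClosed_iInter fun ℓ => isClosed_iInter fun _ => isClosed_eq ?_ ?_
    · have h4 : Continuous fun u : PiLp 2 (fun _ : Comp N d => L2 N d) =>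
          ((√(κ p.1) : ℝ) : ℂ) • u .state := (hcont .state).fun_const_smul _
      exact ℓ.1.continuous.comp h4
    · exact (ℓ.2.continuous.comp (hcont (.grad p))).neg
  have h3 : (formSubmodule κ W : Set (PiLp 2 fun _ : Comp N d => L2 N d)) =
      {u | IsSqrtMul W (u .state) (u .pot)} ∩
        ⋂ p, {u | IsWeakDeriv p (((√(κ p.1) : ℝ) : ℂ) • u .state) (u (.grad p))} := by
    ext u
    simp [formSubmodule]
  rw [h3]
  exact h1.inter (isClosed_iInter h2)

/-- The form domain of `T = 𝒦₀ + 1` with the form of `T` as inner product. -/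
abbrev FormDomain {N d : ℕ} (κ : Fin N → ℝ) (W : Cfg N d → ℝ) : Type := ↥(formSubmodule κ W)

instance {N d : ℕ} (κ : Fin N → ℝ) (W : Cfg N d → ℝ) : CompleteSpace (FormDomain κ W) :=
  (isClosed_formSubmodule κ W).completeSpace_coe

/-- The inclusion of the form domain into `L²`. -/
def incl {N d : ℕ} (κ : Fin N → ℝ) (W : Cfg N d → ℝ) : FormDomain κ W →L[ℂ] L2 N d :=
  (PiLp.proj 2 (fun _ : Comp N d => L2 N d) .state) ∘L (formSubmodule κ W).subtypeL

variable {N d : ℕ} {κ : Fin N → ℝ} {W : Cfg N d → ℝ}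

/-- The form of `𝒦₀ = -∑ⱼ κⱼ Δⱼ + 𝒲`. -/
def freeForm (u v : FormDomain κ W) : ℂ :=
  inner ℂ (u.1 .pot) (v.1 .pot) + ∑ p, inner ℂ (u.1 (.grad p)) (v.1 (.grad p))

/-- `⟨f| b |g⟩` for the multiplication operator by `b`. -/
def mulForm (b : Cfg N d → ℂ) (f g : L2 N d) : ℂ :=
  ∫ x, starRingEnd ℂ (f x) * b x * g x

end Particles

/-! ## The classical field -/

section Field

/-- A one-excitation energy: a positive self-adjoint operator with trivial kernel. -/
structure Dispersion (𝔥 : Type*) [NormedAddCommGroup 𝔥] [InnerProductSpace ℂ 𝔥]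
    [CompleteSpace 𝔥] where
  /-- the operator `ω` -/
  op : 𝔥 →ₗ.[ℂ] 𝔥
  selfAdjoint : IsSelfAdjoint op
  nonneg : ∀ x : op.domain, 0 ≤ inner ℂ (x : 𝔥) (op x)
  injective : Function.Injective op

variable {𝔥 : Type*} [NormedAddCommGroup 𝔥] [InnerProductSpace ℂ 𝔥] [CompleteSpace 𝔥]

namespace Dispersion

variable (ω : Dispersion 𝔥)

/-- The domain of `ω ^ k`. -/
def powDomain : ℕ → Submodule ℂ 𝔥
  | 0 => ⊤
  | k + 1 => ((powDomain k).comap ω.op.toFun).map ω.op.domain.subtype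

theorem mem_domain_of_mem {x : 𝔥} (hx : x ∈ ⨅ k, ω.powDomain k) : x ∈ ω.op.domain := by
  have h := (Submodule.mem_iInf _).mp hx 1
  obtain ⟨y, -, rfl⟩ := h
  exact y.2

/-- `⋂ₖ 𝒟(ωᵏ)`, to be normed by the form of `ω`. -/
def SmoothVec : Type _ := ↥(⨅ k, ω.powDomain k)

instance : AddCommGroup ω.SmoothVec := inferInstanceAs (AddCommGroup ↥(⨅ k, ω.powDomain k))

instance : Module ℂ ω.SmoothVec := inferInstanceAs (Module ℂ ↥(⨅ k, ω.powDomain k))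

/-- The inclusion of `⋂ₖ 𝒟(ωᵏ)` in the domain of `ω`. -/
def toDomain : ω.SmoothVec →ₗ[ℂ] ω.op.domain :=
  Submodule.inclusion fun _ hx => ω.mem_domain_of_mem hx

/-- The inner product `⟨x|ω|y⟩` on `⋂ₖ 𝒟(ωᵏ)`. -/
@[reducible] def formCore : PreInnerProductSpace.Core ℂ ω.SmoothVec where
  inner x y := inner ℂ (ω.toDomain x : 𝔥) (ω.op (ω.toDomain y))
  conj_inner_symm x y := by
    have h : ω.op.IsFormalAdjoint ω.op := by
      have h1 := LinearPMap.adjoint_isFormalAdjoint ω.selfAdjoint.dense_domain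
      rwa [LinearPMap.isSelfAdjoint_def.mp ω.selfAdjoint] at h1
    rw [inner_conj_symm]
    exact h _ _
  re_inner_nonneg x := (Complex.nonneg_iff.mp (ω.nonneg _)).1
  add_left x y z := by simp
  smul_left x y r := by simp [mul_comm]

instance : SeminormedAddCommGroup ω.SmoothVec :=
  @InnerProductSpace.Core.toSeminormedAddCommGroup ℂ _ _ _ _ (formCore ω)

instance : InnerProductSpace ℂ ω.SmoothVec := InnerProductSpace.ofCore (formCore ω)

/-- The space `𝔥_ω` of classical field configurations: the Hilbert completion of `⋂ₖ 𝒟(ωᵏ)` for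
the inner product `⟨·|ω|·⟩`. -/
abbrev FieldSpace : Type _ := UniformSpace.Completion ω.SmoothVec

instance : MeasurableSpace ω.FieldSpace := borel _

instance : BorelSpace ω.FieldSpace := ⟨rfl⟩

/-- `v ∈ 𝒟(ω^{-1/2})` with `‖ω^{-1/2} v‖ ≤ C`: the functional `y ↦ ⟨v|y⟩` is bounded by `C` for
the norm of `𝔥_ω`. -/
def InvSqrtBound (v : 𝔥) (C : ℝ) : Prop :=
  ∀ y : ω.SmoothVec, ‖inner ℂ v (ω.toDomain y : 𝔥)‖ ≤ C * ‖y‖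

/-- `⟨v|z⟩ = ⟨ω^{-1/2} v|ω^{1/2} z⟩` for `v ∈ 𝒟(ω^{-1/2})` and `z ∈ 𝔥_ω`: the continuous extension
of `y ↦ ⟨v|y⟩` from `⋂ₖ 𝒟(ωᵏ)`. -/
def pairing (v : 𝔥) (z : ω.FieldSpace) : ℂ :=
  UniformSpace.Completion.extension (fun y : ω.SmoothVec => inner ℂ v (ω.toDomain y : 𝔥)) z

/-- `λ, ω^{-1/2} λ ∈ L^∞(ℝᵈ; 𝔥)`. -/
def IsFormFactor {d : ℕ} (lam : EuclideanSpace ℝ (Fin d) → 𝔥) : Prop :=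
  MemLp lam ⊤ volume ∧ ∃ C : ℝ, ∀ᵐ x, ω.InvSqrtBound (lam x) C

/-- The classical field `2 Re ⟨z|λ(x)⟩`. -/
def classicalField {d : ℕ} (lam : EuclideanSpace ℝ (Fin d) → 𝔥) (z : ω.FieldSpace)
    (x : EuclideanSpace ℝ (Fin d)) : ℝ :=
  2 * (ω.pairing (lam x) z).re

end Dispersion

end Field

/-! ## The three models -/

section Models

variable {N d : ℕ} {κ : Fin N → ℝ} {W : Cfg N d → ℝ}
  {𝔥 : Type*} [NormedAddCommGroup 𝔥] [InnerProductSpace ℂ 𝔥] [CompleteSpace 𝔥]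

/-- Nelson model: the form of `ℋ_z = 𝒦₀ + ∑ⱼ 2 Re ⟨z|λ(xⱼ)⟩ + ⟨z|ω|z⟩`. -/
def nelsonForm (ω : Dispersion 𝔥) (lam : EuclideanSpace ℝ (Fin d) → 𝔥) (z : ω.FieldSpace)
    (u v : FormDomain κ W) : ℂ :=
  freeForm u v
    + ∑ j, mulForm (fun x => (ω.classicalField lam z (pos x j) : ℂ)) (u.1 .state) (v.1 .state)
    + ((‖z‖ ^ 2 : ℝ) : ℂ) * inner ℂ (u.1 .state) (v.1 .state)

/-- The field space `𝔥_ω = L²(ℝᵈ)` of the polaron, where `ω = 1`. -/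
abbrev PolaronSpace (d : ℕ) : Type := Lp ℂ 2 (volume : Measure (EuclideanSpace ℝ (Fin d)))

instance (d : ℕ) : MeasurableSpace (PolaronSpace d) := borel _

instance (d : ℕ) : BorelSpace (PolaronSpace d) := ⟨rfl⟩

/-- `∫ \overline{z(k)} e^{-i k·x} χ(k) dk`. -/
def polaronPairing (χ : EuclideanSpace ℝ (Fin d) → ℝ) (z : PolaronSpace d)
    (x : EuclideanSpace ℝ (Fin d)) : ℂ :=
  ∫ k, starRingEnd ℂ (z k) * Complex.exp (-(Complex.I * ((inner ℝ k x : ℝ) : ℂ))) * (χ k : ℂ)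

/-- Low-frequency part of the form factor: `1_{|k| ≤ r} |k|^{-(d-1)/2}`. -/
def polaronLow (r : ℝ) (k : EuclideanSpace ℝ (Fin d)) : ℝ :=
  if ‖k‖ ≤ r then ‖k‖ ^ (-((d : ℝ) - 1) / 2) else 0

/-- High-frequency part: the `i`-th component of `1_{|k| > r} |k|^{-(d+1)/2} k / |k|`. -/
def polaronHigh (r : ℝ) (i : Fin d) (k : EuclideanSpace ℝ (Fin d)) : ℝ :=
  if r < ‖k‖ then ‖k‖ ^ (-((d : ℝ) + 1) / 2) * (k i / ‖k‖) else 0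

/-- The bounded function `2 Re ∫_{|k| ≤ r} \overline{z(k)} e^{-i k·x} |k|^{-(d-1)/2} dk`. -/
def polaronLowField (r : ℝ) (z : PolaronSpace d) (x : EuclideanSpace ℝ (Fin d)) : ℝ :=
  2 * (polaronPairing (polaronLow r) z x).re

/-- The bounded vector field whose divergence is the high-frequency part
`2 Re ∫_{|k| > r} \overline{z(k)} e^{-i k·x} |k|^{-(d-1)/2} dk` of the potential. -/
def polaronHighField (r : ℝ) (z : PolaronSpace d) (i : Fin d)
    (x : EuclideanSpace ℝ (Fin d)) : ℝ :=
  2 * (Complex.I * polaronPairing (polaronHigh r i) z x).re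

/-- Fröhlich polaron: the form of `ℋ_z = 𝒦₀ + ∑ⱼ 𝒱_z(xⱼ) + ‖z‖²` with `κ = 1` and
`𝒱_z = √α (𝒱_< + ∇·𝒱_>) = √α (𝒱_< + [∇, 𝒱_>])`; the commutator is a form on `Q`, namely
`⟨f|[∂ᵢ, c]|g⟩ = -⟨∂ᵢ f|c|g⟩ - ⟨f|c|∂ᵢ g⟩`.  The cutoff `r > 0` is arbitrary. -/
def polaronForm (α r : ℝ) (z : PolaronSpace d) (u v : FormDomain (fun _ : Fin N => (1 : ℝ)) W) :
    ℂ :=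
  freeForm u v
    + ((√α : ℝ) : ℂ) * ∑ j,
      (mulForm (fun x => (polaronLowField r z (pos x j) : ℂ)) (u.1 .state) (v.1 .state)
        - ∑ i, (mulForm (fun x => (polaronHighField r z i (pos x j) : ℂ))
              (u.1 (.grad (j, i))) (v.1 .state)
            + mulForm (fun x => (polaronHighField r z i (pos x j) : ℂ))
              (u.1 .state) (v.1 (.grad (j, i)))))
    + ((‖z‖ ^ 2 : ℝ) : ℂ) * inner ℂ (u.1 .state) (v.1 .state)

/-- The kinetic coefficients `1 / (2 mⱼ)`. -/
def massCoeff (m : Fin N → ℝ) (j : Fin N) : ℝ := 1 / (2 * m j)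

/-- `√κⱼ (-i ∂_{j,i} + e a_{z,j,i}(xⱼ)) ψ`. -/
def covDeriv {W : Cfg N 3 → ℝ} (ω : Dispersion 𝔥)
    (lam : Fin N → Fin 3 → EuclideanSpace ℝ (Fin 3) → 𝔥) (e : ℝ) (z : ω.FieldSpace)
    (u : FormDomain κ W) (p : Fin N × Fin 3) (x : Cfg N 3) : ℂ :=
  -Complex.I * u.1 (.grad p) x
    + ((√(κ p.1) * e * ω.classicalField (lam p.1 p.2) z (pos x p.1) : ℝ) : ℂ) * u.1 .state x

/-- Pauli-Fierz model: the form of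
`ℋ_z = ∑ⱼ (1 / (2 mⱼ)) (-i ∇ⱼ + e a_{z,j}(xⱼ))² + 𝒲 + ⟨z|ω|z⟩`, with
`a_{z,j}(x) = 2 Re ⟨z|λⱼ(x)⟩`. -/
def pauliFierzForm {W : Cfg N 3 → ℝ} (ω : Dispersion 𝔥)
    (lam : Fin N → Fin 3 → EuclideanSpace ℝ (Fin 3) → 𝔥) (e : ℝ) (z : ω.FieldSpace)
    (u v : FormDomain κ W) : ℂ :=
  (∑ p, ∫ x, starRingEnd ℂ (covDeriv ω lam e z u p x) * covDeriv ω lam e z v p x)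
    + inner ℂ (u.1 .pot) (v.1 .pot)
    + ((‖z‖ ^ 2 : ℝ) : ℂ) * inner ℂ (u.1 .state) (v.1 .state)

end Models

end QuasiClassical

end

/-!
Write `R = T^{-1/2}`, `A_z = T^{-1/2} ℋ_z T^{-1/2}`, which is bounded, and `E` for the infimum of
the energy.  Vector states are pure, and testing on them gives `G_z = A_z - E R² ≥ 0`.  The
resolvent `K_z = (ℋ_z - E + 1)⁻¹ = R (G_z + R²)⁻¹ R` satisfies `0 ≤ K_z ≤ 1`, and `(ϱ, z)` is a
minimizer if and only if `ϱ[K_z] = 1`.  Hence the minimizers at fixed `z` form a weak-* compact face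
of the set of generalized states, and the Krein–Milman theorem produces pure minimizers and shows
that every minimizer is in the closed convex hull of the pure ones.

Dirac measures show that the minimal energy of measures is at most `E`.  Conversely, a generalized
state-valued measure has a weak-* density with respect to its norm measure: differentiate the scalar
measures `S ↦ 𝔫(S)[B]` along a refining sequence of countable partitions, and read the limit along
an ultrafilter so that it is linear in `B`.  Minimality of `𝔫` then forces the density of `𝔫_T` to
vanish on `G_z` for almost every `z`, which is the same as `ϱ_z[K_z] = 1`.

In each of the three models `ℋ_z - T` is a first-order form perturbation with bounded coefficients,
so `ℋ_z` is coercive on the form domain.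
-/

noncomputable section

open MeasureTheory Filter Topology
open scoped ComplexOrder InnerProductSpace ENNReal

namespace QuasiClassical

section PositiveFunctionals

variable {A : Type*} [CStarAlgebra A]

/-- The functional `b ↦ ρ (c⋆ b c)`. -/
def conjFunctional (ρ : StrongDual ℂ A) (c : A) : StrongDual ℂ A :=
  ρ ∘L (ContinuousLinearMap.mul ℂ A (star c) ∘L (ContinuousLinearMap.mul ℂ A).flip c)

@[simp]
theorem conjFunctional_apply (ρ : StrongDual ℂ A) (c b : A) :
    conjFunctional ρ c b = ρ (star c * b * c) := by
  simp [conjFunctional, mul_assoc]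

variable [PartialOrder A] [StarOrderedRing A] {ρ : StrongDual ℂ A}

theorem conjFunctional_nonneg (hρ : ∀ a, 0 ≤ a → 0 ≤ ρ a) (c : A) (b : A) (hb : 0 ≤ b) :
    0 ≤ conjFunctional ρ c b := by
  rw [conjFunctional_apply]
  exact hρ _ (star_left_conjugate_nonneg hb c)

theorem norm_toPreGNS_sqrt_eq_zero (f : A →ₚ[ℂ] ℂ) {d : A} (hd : 0 ≤ d) (h0 : f d = 0) :
    ‖f.toPreGNS (CFC.sqrt d)‖ = 0 := by
  rw [PositiveLinearMap.preGNS_norm_def, PositiveLinearMap.ofPreGNS_toPreGNS,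
    (CFC.sqrt_nonneg d).isSelfAdjoint.star_eq, CFC.sqrt_mul_sqrt_self d hd, h0]
  simp

theorem map_mul_eq_zero_of_left (hρ : ∀ a, 0 ≤ a → 0 ≤ ρ a) {d : A} (hd : 0 ≤ d)
    (h0 : ρ d = 0) (b : A) : ρ (d * b) = 0 := by
  let f : A →ₚ[ℂ] ℂ := PositiveLinearMap.mk₀ ρ.toLinearMap hρ
  have cauchySchwarz :=
    norm_inner_le_norm (𝕜 := ℂ) (f.toPreGNS (CFC.sqrt d)) (f.toPreGNS (CFC.sqrt d * b))
  rw [norm_toPreGNS_sqrt_eq_zero f hd h0, zero_mul, PositiveLinearMap.preGNS_inner_def,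
    PositiveLinearMap.ofPreGNS_toPreGNS, PositiveLinearMap.ofPreGNS_toPreGNS,
    (CFC.sqrt_nonneg d).isSelfAdjoint.star_eq, ← mul_assoc, CFC.sqrt_mul_sqrt_self d hd]
    at cauchySchwarz
  exact norm_le_zero_iff.mp cauchySchwarz

theorem map_mul_eq_zero_of_right (hρ : ∀ a, 0 ≤ a → 0 ≤ ρ a) {d : A} (hd : 0 ≤ d)
    (h0 : ρ d = 0) (b : A) : ρ (b * d) = 0 := by
  let f : A →ₚ[ℂ] ℂ := PositiveLinearMap.mk₀ ρ.toLinearMap hρ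
  have cauchySchwarz :=
    norm_inner_le_norm (𝕜 := ℂ) (f.toPreGNS (star (b * CFC.sqrt d))) (f.toPreGNS (CFC.sqrt d))
  rw [norm_toPreGNS_sqrt_eq_zero f hd h0, mul_zero, PositiveLinearMap.preGNS_inner_def,
    PositiveLinearMap.ofPreGNS_toPreGNS, PositiveLinearMap.ofPreGNS_toPreGNS, star_star,
    mul_assoc, CFC.sqrt_mul_sqrt_self d hd] at cauchySchwarz
  exact norm_le_zero_iff.mp cauchySchwarz

theorem map_compress_eq_of_map_eq_map_one (hρ : ∀ a, 0 ≤ a → 0 ≤ ρ a) {k : A} (hk : k ≤ 1)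
    (h1 : ρ k = ρ 1) (b : A) : ρ (k * b * k) = ρ b := by
  have hd : 0 ≤ 1 - k := sub_nonneg.mpr hk
  have h0 : ρ (1 - k) = 0 := by rw [map_sub, h1, sub_self]
  have hleft : ρ (b * k) = ρ (k * (b * k)) := by
    simpa only [sub_mul, one_mul, map_sub, sub_eq_zero]
      using map_mul_eq_zero_of_left hρ hd h0 (b * k)
  have hright : ρ b = ρ (b * k) := by
    simpa only [mul_sub, mul_one, map_sub, sub_eq_zero] using map_mul_eq_zero_of_right hρ hd h0 b
  rw [mul_assoc, ← hleft, ← hright]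

end PositiveFunctionals

section FormResolvent

variable {A : Type*} [CStarAlgebra A] {r g : A}

/-- The resolvent `(h + 1)⁻¹` of an operator `h`, in terms of the bounded operators `r = T^{-1/2}`
and `g = r h r`: since `g + r² = r (h + 1) r`, it is `r (g + r²)⁻¹ r`. If `g + r²` is not
invertible, the value is `0`. -/
def formResolvent (r g : A) : A := r * Ring.inverse (g + r * r) * r

theorem formResolvent_sub_mul_self (hu : IsUnit (g + r * r)) :
    formResolvent r g - formResolvent r g * formResolvent r g =
      r * Ring.inverse (g + r * r) * g * (Ring.inverse (g + r * r) * r) := by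
  have hcancel := Ring.inverse_mul_cancel _ hu
  rw [formResolvent]
  set n := Ring.inverse (g + r * r)
  calc r * n * r - r * n * r * (r * n * r)
      = r * (n * (g + r * r)) * n * r - r * n * r * (r * n * r) := by rw [hcancel, mul_one]
    _ = r * n * g * (n * r) := by noncomm_ring

variable [PartialOrder A] [StarOrderedRing A]

theorem isSelfAdjoint_inverse_add_mul_self (hr : IsSelfAdjoint r) (hg : 0 ≤ g) :
    IsSelfAdjoint (Ring.inverse (g + r * r)) :=
  (hg.isSelfAdjoint.add (hr.commute_iff hr |>.mp (Commute.refl r))).ringInverse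

theorem isSelfAdjoint_formResolvent (hr : IsSelfAdjoint r) (hg : 0 ≤ g) :
    IsSelfAdjoint (formResolvent r g) := by
  simpa only [formResolvent, hr.star_eq] using
    (isSelfAdjoint_inverse_add_mul_self hr hg).conjugate r

theorem formResolvent_sub_mul_self_nonneg (hr : IsSelfAdjoint r) (hg : 0 ≤ g)
    (hu : IsUnit (g + r * r)) :
    0 ≤ formResolvent r g - formResolvent r g * formResolvent r g := by
  rw [formResolvent_sub_mul_self hu]
  simpa only [star_mul, hr.star_eq, (isSelfAdjoint_inverse_add_mul_self hr hg).star_eq] using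
    star_left_conjugate_nonneg hg (Ring.inverse (g + r * r) * r)

theorem formResolvent_nonneg (hr : IsSelfAdjoint r) (hg : 0 ≤ g) (hu : IsUnit (g + r * r)) :
    0 ≤ formResolvent r g := by
  have hsq := (isSelfAdjoint_formResolvent hr hg).mul_self_nonneg
  simpa only [sub_add_cancel] using add_nonneg (formResolvent_sub_mul_self_nonneg hr hg hu) hsq

theorem formResolvent_le_one (hr : IsSelfAdjoint r) (hg : 0 ≤ g) (hu : IsUnit (g + r * r)) :
    formResolvent r g ≤ 1 := by
  have hsq := ((IsSelfAdjoint.one A).sub (isSelfAdjoint_formResolvent hr hg)).mul_self_nonneg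
  rw [← sub_nonneg]
  convert add_nonneg (formResolvent_sub_mul_self_nonneg hr hg hu) hsq using 1
  noncomm_ring

theorem norm_formResolvent_le_one (hr : IsSelfAdjoint r) (hg : 0 ≤ g) (hu : IsUnit (g + r * r)) :
    ‖formResolvent r g‖ ≤ 1 :=
  (CStarAlgebra.norm_le_one_iff_of_nonneg _ (formResolvent_nonneg hr hg hu)).mpr
    (formResolvent_le_one hr hg hu)

theorem isUnit_add_mul_self (hr : IsSelfAdjoint r) (hg : 0 ≤ g) {δ C : ℝ} (hδ : 0 < δ)
    (hle : δ • (1 : A) ≤ g + C • (r * r)) : IsUnit (g + r * r) := by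
  have hC : 0 < max C 1 := lt_max_of_lt_right one_pos
  have hle' : δ • (1 : A) ≤ max C 1 • (g + r * r) := calc
    δ • (1 : A) ≤ g + C • (r * r) := hle
    _ ≤ max C 1 • g + max C 1 • (r * r) := by
      gcongr
      · exact le_smul_of_one_le_left hg (le_max_right _ _)
      · exact hr.mul_self_nonneg
      · exact le_max_left _ _
    _ = max C 1 • (g + r * r) := (smul_add _ _ _).symm
  have hunit : IsUnit (max C 1 • (g + r * r)) :=
    CStarAlgebra.isUnit_of_le _ hle' (IsStrictlyPositive.smul hδ isStrictlyPositive_one)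
  exact (isUnit_smul_iff (Units.mk0 _ hC.ne') _).mp hunit

variable {ρ : StrongDual ℂ A}

theorem map_mul_formResolvent_mul (hg : 0 ≤ g) (hu : IsUnit (g + r * r))
    (hρ : ∀ a, 0 ≤ a → 0 ≤ ρ a) (h0 : ρ g = 0) :
    ρ (r * formResolvent r g * r) = ρ (r * r) := by
  have hleft := Ring.inverse_mul_cancel _ hu
  have hright := Ring.mul_inverse_cancel _ hu
  have hexpand : r * formResolvent r g * r
      = r * r - g + g * (Ring.inverse (g + r * r) * g) := by
    rw [formResolvent]
    set n := Ring.inverse (g + r * r)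
    calc r * (r * n * r) * r
        = ((g + r * r) * n) * (g + r * r) - (g + r * r) * n * g - g * (n * (g + r * r))
          + g * (n * g) := by noncomm_ring
      _ = r * r - g + g * (n * g) := by rw [hleft, hright]; noncomm_ring
  rw [hexpand, map_add, map_sub, h0, map_mul_eq_zero_of_left hρ hg h0]
  simp

theorem conjFunctional_apply_conjugate (hr : IsSelfAdjoint r) (hg : 0 ≤ g)
    (hu : IsUnit (g + r * r)) (hρ : ∀ a, 0 ≤ a → 0 ≤ ρ a) (h1 : ρ (formResolvent r g) = ρ 1)
    (b : A) : conjFunctional ρ (Ring.inverse (g + r * r) * r) (r * b * r) = ρ b := by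
  rw [conjFunctional_apply, star_mul, hr.star_eq,
    (isSelfAdjoint_inverse_add_mul_self hr hg).star_eq,
    ← map_compress_eq_of_map_eq_map_one hρ (formResolvent_le_one hr hg hu) h1 b, formResolvent]
  simp only [mul_assoc]

theorem conjFunctional_apply_eq_zero (hr : IsSelfAdjoint r) (hg : 0 ≤ g)
    (hu : IsUnit (g + r * r)) (hρ : ∀ a, 0 ≤ a → 0 ≤ ρ a) (h1 : ρ (formResolvent r g) = ρ 1) :
    conjFunctional ρ (Ring.inverse (g + r * r) * r) g = 0 := by
  have hsq := map_compress_eq_of_map_eq_map_one hρ (formResolvent_le_one hr hg hu) h1 1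
  rw [mul_one] at hsq
  rw [conjFunctional_apply, star_mul, hr.star_eq,
    (isSelfAdjoint_inverse_add_mul_self hr hg).star_eq, ← formResolvent_sub_mul_self hu, map_sub,
    h1, hsq, sub_self]

end FormResolvent

section TraceClassDensity

theorem eq_zero_of_forall_re_lt {E : Type*} [AddCommGroup E] [Module ℂ E] {P : Submodule ℂ E}
    {f : E →ₗ[ℂ] ℂ} {u : ℝ} (hf : ∀ g ∈ P, (f g).re < u) {g : E} (hg : g ∈ P) : f g = 0 := by
  by_contra hne
  have hscaled := hf _ (P.smul_mem (u / f g) hg)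
  rw [map_smul, smul_eq_mul, div_mul_cancel₀ _ hne, Complex.ofReal_re] at hscaled
  exact lt_irrefl u hscaled

theorem dense_of_forall_dual_eq_zero {E : Type*} [AddCommGroup E] [Module ℂ E] [Module ℝ E]
    [IsScalarTower ℝ ℂ E] [TopologicalSpace E] [IsTopologicalAddGroup E] [ContinuousSMul ℂ E]
    [LocallyConvexSpace ℝ E] (P : Submodule ℂ E)
    (hP : ∀ f : StrongDual ℂ E, (∀ g ∈ P, f g = 0) → f = 0) : Dense (P : Set E) := by
  intro x
  by_contra hx
  have : ContinuousSMul ℝ E := IsScalarTower.continuousSMul ℂ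
  obtain ⟨f, u, hfP, hfx⟩ := RCLike.geometric_hahn_banach_closed_point (𝕜 := ℂ)
    (P.restrictScalars ℝ).convex.closure isClosed_closure hx
  have hf : f = 0 := hP f fun g hg =>
    eq_zero_of_forall_re_lt (f := f.toLinearMap) (fun h hh => hfP h (subset_closure hh)) hg
  have hu : (0 : ℝ) < u := by simpa using hfP 0 (subset_closure P.zero_mem)
  have hux : u < 0 := by simpa [hf] using hfx
  exact hu.asymm hux

variable {H : Type*} [NormedAddCommGroup H] [InnerProductSpace ℂ H]

/-- The rank one functional `B ↦ ⟪x, B y⟫`; for `x = y` a unit vector, this is a vector state. -/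
def vecFunctional (x y : H) : StrongDual ℂ (BOp H) :=
  innerSL ℂ x ∘L ContinuousLinearMap.apply ℂ H y

@[simp]
theorem vecFunctional_apply (x y : H) (B : BOp H) : vecFunctional x y B = inner ℂ x (B y) := rfl

theorem sum_vecFunctional_mem_traceClassFunctionals {k : ℕ} (x y : Fin k → H) :
    StrongDual.toWeakDual (∑ i, vecFunctional (x i) (y i)) ∈ traceClassFunctionals H := by
  have hout : ∀ (v : Fin k → H), ∀ n ∉ Finset.range k, Function.extend Fin.val v 0 n = 0 := by
    intro v n hn
    refine Function.extend_apply' _ _ _ ?_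
    rintro ⟨i, rfl⟩
    exact hn (Finset.mem_range.mpr i.2)
  refine ⟨Function.extend Fin.val x 0, Function.extend Fin.val y 0,
    summable_of_ne_finset_zero (s := Finset.range k) fun n hn => by simp [hout x n hn],
    summable_of_ne_finset_zero (s := Finset.range k) fun n hn => by simp [hout y n hn],
    fun B => ?_⟩
  rw [tsum_eq_sum (s := Finset.range k) fun n hn => by simp [hout x n hn],
    ← Fin.sum_univ_eq_sum_range fun n => inner ℂ (Function.extend Fin.val x 0 n)
      (B (Function.extend Fin.val y 0 n))]
  simp only [Fin.val_injective.extend_apply]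
  exact sum_apply (F := StrongDual ℂ (BOp H)) _ _ B

theorem span_vecFunctional_subset :
    (Submodule.span ℂ (Set.range fun p : H × H => StrongDual.toWeakDual (vecFunctional p.1 p.2)) :
      Set (WeakDual ℂ (BOp H))) ⊆ traceClassFunctionals H := by
  intro F hF
  obtain ⟨k, c, g, rfl⟩ := Submodule.mem_span_set'.mp hF
  choose p hp using fun i => (g i).2
  convert sum_vecFunctional_mem_traceClassFunctionals (fun i => (p i).1) fun i => c i • (p i).2
  rw [map_sum]
  refine Finset.sum_congr rfl fun i _ => ?_
  rw [← hp i, ← map_smul]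
  congr 1
  ext B
  simp

instance isScalarTower_weakDual : IsScalarTower ℝ ℂ (WeakDual ℂ (BOp H)) :=
  inferInstanceAs (IsScalarTower ℝ ℂ (StrongDual ℂ (BOp H)))

instance continuousSMul_weakDual : ContinuousSMul ℝ (WeakDual ℂ (BOp H)) :=
  WeakDual.instContinuousSMul ℝ

instance locallyConvexSpace_weakDual : LocallyConvexSpace ℝ (WeakDual ℂ (BOp H)) :=
  inferInstanceAs (LocallyConvexSpace ℝ (WeakBilin (topDualPairing ℂ (BOp H))))

theorem dense_traceClassFunctionals : Dense (traceClassFunctionals H) := by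
  refine (dense_of_forall_dual_eq_zero _ fun f hf => ?_).mono span_vecFunctional_subset
  obtain ⟨B, rfl⟩ := LinearMap.dualEmbedding_surjective (topDualPairing ℂ (BOp H)) f
  have hB : B = 0 := by
    ext y
    exact inner_self_eq_zero.mp (hf _ (Submodule.subset_span ⟨(B y, y), rfl⟩))
  exact hB ▸ map_zero _

end TraceClassDensity

section States

variable {H : Type*} [NormedAddCommGroup H] [InnerProductSpace ℂ H]

theorem mem_genPositive_iff {ρ : StrongDual ℂ (BOp H)} :
    ρ ∈ genPositive H ↔ ∀ B : BOp H, 0 ≤ B → 0 ≤ ρ B :=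
  ⟨fun h => h.2, fun h => ⟨dense_traceClassFunctionals _, h⟩⟩

theorem vecFunctional_self_nonneg (x : H) (B : BOp H) (hB : 0 ≤ B) : 0 ≤ vecFunctional x x B :=
  ((ContinuousLinearMap.nonneg_iff_isPositive B).mp hB).inner_nonneg_right x

theorem rankOne_mul_mul_rankOne (x : H) (B : BOp H) :
    InnerProductSpace.rankOne ℂ x x * B * InnerProductSpace.rankOne ℂ x x =
      vecFunctional x x B • InnerProductSpace.rankOne ℂ x x := by
  ext y
  simp [smul_smul, mul_comm]

variable [CompleteSpace H]

theorem mem_genStates_iff {ρ : StrongDual ℂ (BOp H)} :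
    ρ ∈ genStates H ↔ (∀ B : BOp H, 0 ≤ B → 0 ≤ ρ B) ∧ ρ 1 = 1 := by
  refine (and_congr_left' mem_genPositive_iff).trans (and_congr_right fun h => ?_)
  rw [← norm_eq_of_positive h, Complex.ofReal_eq_one]

theorem convex_genStates : Convex ℝ (genStates H) := by
  intro ρ hρ σ hσ s t hs ht hst
  obtain ⟨hρ₀, hρ₁⟩ := mem_genStates_iff.mp hρ
  obtain ⟨hσ₀, hσ₁⟩ := mem_genStates_iff.mp hσ
  refine mem_genStates_iff.mpr ⟨fun B hB => ?_, ?_⟩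
  · exact add_nonneg (smul_nonneg hs (hρ₀ B hB)) (smul_nonneg ht (hσ₀ B hB))
  · simp only [add_apply, smul_apply, hρ₁, hσ₁, ← add_smul, hst, one_smul]

theorem vecFunctional_mem_genStates {x : H} (hx : ‖x‖ = 1) : vecFunctional x x ∈ genStates H :=
  mem_genStates_iff.mpr ⟨vecFunctional_self_nonneg x, by simp [inner_self_eq_norm_sq_to_K, hx]⟩

/-- The states `ρ` with `ρ K = 1`; if `K ≤ 1` they form a face of the set of all states. -/
def stateFace (K : BOp H) : Set (StrongDual ℂ (BOp H)) := {ρ | ρ ∈ genStates H ∧ ρ K = 1}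

theorem isExtreme_stateFace {K : BOp H} (hK : K ≤ 1) :
    IsExtreme ℝ (genStates H) (stateFace K) := by
  refine ⟨fun ρ hρ => hρ.1, ?_⟩
  rintro ρ hρ σ hσ τ ⟨-, hτ⟩ ⟨s, t, hs, ht, hst, rfl⟩
  refine ⟨hρ, ?_⟩
  obtain ⟨hρ₀, hρ₁⟩ := mem_genStates_iff.mp hρ
  obtain ⟨hσ₀, hσ₁⟩ := mem_genStates_iff.mp hσ
  have hρK : 0 ≤ 1 - ρ K := by simpa [hρ₁] using hρ₀ _ (sub_nonneg.mpr hK)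
  have hσK : 0 ≤ 1 - σ K := by simpa [hσ₁] using hσ₀ _ (sub_nonneg.mpr hK)
  have hsum : s • (1 - ρ K) + t • (1 - σ K) = 0 := by
    rw [smul_sub, smul_sub, sub_add_sub_comm, ← add_smul, hst, one_smul, sub_eq_zero]
    exact hτ.symm
  have hzero := ((add_eq_zero_iff_of_nonneg (smul_nonneg hs.le hρK) (smul_nonneg ht.le hσK)).mp
    hsum).1
  exact (sub_eq_zero.mp ((smul_eq_zero.mp hzero).resolve_left hs.ne')).symm

theorem stateFace_rankOne {x : H} (hx : ‖x‖ = 1) :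
    stateFace (InnerProductSpace.rankOne ℂ x x) = {vecFunctional x x} := by
  have hle : InnerProductSpace.rankOne ℂ x x ≤ 1 :=
    (InnerProductSpace.isStarProjection_rankOne_self hx).le_one
  ext ρ
  constructor
  · rintro ⟨hρ, hρx⟩
    obtain ⟨hρ₀, hρ₁⟩ := mem_genStates_iff.mp hρ
    refine ContinuousLinearMap.ext fun B => ?_
    rw [← map_compress_eq_of_map_eq_map_one hρ₀ hle (hρx.trans hρ₁.symm) B,
      rankOne_mul_mul_rankOne, map_smul, hρx, smul_eq_mul, mul_one]
  · rintro rfl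
    exact ⟨vecFunctional_mem_genStates hx, by simp [inner_self_eq_norm_sq_to_K, hx]⟩

theorem vecFunctional_mem_genPureStates {x : H} (hx : ‖x‖ = 1) :
    vecFunctional x x ∈ genPureStates H := by
  rw [genPureStates, ← isExtreme_singleton, ← stateFace_rankOne hx]
  exact isExtreme_stateFace (InnerProductSpace.isStarProjection_rankOne_self hx).le_one

theorem isCompact_toWeakDual_image_stateFace (K : BOp H) :
    IsCompact (StrongDual.toWeakDual '' stateFace K) := by
  have heq : StrongDual.toWeakDual '' stateFace K =
      {F : WeakDual ℂ (BOp H) | (∀ B : BOp H, 0 ≤ B → 0 ≤ F B) ∧ F 1 = 1 ∧ F K = 1} := by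
    rw [LinearEquiv.image_eq_preimage_symm]
    ext F
    exact (and_congr_left' mem_genStates_iff).trans and_assoc
  refine WeakDual.isCompact_of_bounded_of_closed ?_ ?_
  · refine (Metric.isBounded_closedBall (x := (0 : StrongDual ℂ (BOp H))) (r := 1)).subset ?_
    rintro _ ⟨ρ, ⟨hρ, -⟩, rfl⟩
    exact mem_closedBall_zero_iff.mpr hρ.2.le
  · rw [heq]
    simp only [Set.ofPred_and, Set.ofPred_forall]
    exact (isClosed_iInter fun B => isClosed_iInter fun _ =>
      isClosed_le continuous_const (WeakDual.eval_continuous B)).inter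
      ((isClosed_eq (WeakDual.eval_continuous 1) continuous_const).inter
        (isClosed_eq (WeakDual.eval_continuous K) continuous_const))

theorem convex_stateFace (K : BOp H) : Convex ℝ (stateFace K) := by
  intro ρ hρ σ hσ s t hs ht hst
  refine ⟨convex_genStates hρ.1 hσ.1 hs ht hst, ?_⟩
  simp only [add_apply, smul_apply, hρ.2, hσ.2, ← add_smul, hst, one_smul]

theorem extremePoints_stateFace {K : BOp H} (hK : K ≤ 1) :
    (stateFace K).extremePoints ℝ = {σ | σ ∈ genPureStates H ∧ σ K = 1} := by
  rw [(isExtreme_stateFace hK).extremePoints_eq]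
  ext σ
  exact ⟨fun h => ⟨h.2, h.1.2⟩, fun h => ⟨⟨h.1.1, h.2⟩, h.1⟩⟩

/-- The identification of the dual with the weak-* dual, over the real scalars that convexity
refers to. -/
def toWeakDualReal : StrongDual ℂ (BOp H) ≃ₗ[ℝ] WeakDual ℂ (BOp H) :=
  StrongDual.toWeakDual.restrictScalars ℝ

theorem extremePoints_toWeakDual_image_stateFace {K : BOp H} (hK : K ≤ 1) :
    (StrongDual.toWeakDual '' stateFace K).extremePoints ℝ =
      StrongDual.toWeakDual '' {σ | σ ∈ genPureStates H ∧ σ K = 1} := by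
  rw [← extremePoints_stateFace hK]
  exact (image_extremePoints toWeakDualReal (stateFace K)).symm

theorem toWeakDual_mem_closure_convexHull_pure {K : BOp H} (hK : K ≤ 1) {ρ : StrongDual ℂ (BOp H)}
    (hρ : ρ ∈ stateFace K) :
    StrongDual.toWeakDual ρ ∈ closure (convexHull ℝ
      (StrongDual.toWeakDual '' {σ | σ ∈ genPureStates H ∧ σ K = 1})) := by
  have hKreinMilman :
      closure (convexHull ℝ ((StrongDual.toWeakDual '' stateFace K).extremePoints ℝ)) =
        StrongDual.toWeakDual '' stateFace K :=
    closure_convexHull_extremePoints (isCompact_toWeakDual_image_stateFace K)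
      ((convex_stateFace K).linear_image toWeakDualReal.toLinearMap)
  rw [← extremePoints_toWeakDual_image_stateFace hK, hKreinMilman]
  exact Set.mem_image_of_mem _ hρ

theorem exists_pure_of_mem_stateFace {K : BOp H} (hK : K ≤ 1) {ρ : StrongDual ℂ (BOp H)}
    (hρ : ρ ∈ stateFace K) : ∃ σ ∈ genPureStates H, σ K = 1 := by
  obtain ⟨F, hF⟩ := (isCompact_toWeakDual_image_stateFace K).extremePoints_nonempty
    ⟨_, Set.mem_image_of_mem _ hρ⟩
  obtain ⟨σ, ⟨hσ, hσK⟩, -⟩ := (extremePoints_toWeakDual_image_stateFace hK).subset hF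
  exact ⟨σ, hσ, hσK⟩

end States

section WeakDensity

open MeasurableSpace ProbabilityTheory

theorem exists_density_tendsto_countablePartitionSet {X : Type*} [MeasurableSpace X]
    [CountablyGenerated X] {μ ν : Measure X} [IsFiniteMeasure μ] (hνμ : ν ≤ μ) :
    ∃ f : X → ℝ, Integrable f μ ∧ (∀ S, MeasurableSet S → ∫ z in S, f z ∂μ = ν.real S) ∧
      ∀ᵐ z ∂μ, Tendsto (fun k => ν.real (countablePartitionSet k z) /
        μ.real (countablePartitionSet k z)) atTop (𝓝 (f z)) := by
  let κ : Kernel Unit (X × Unit) := Kernel.const Unit (ν.map fun x => (x, ()))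
  let η : Kernel Unit X := Kernel.const Unit μ
  have : IsFiniteMeasure ν := isFiniteMeasure_of_le μ hνμ
  have hκ : ∀ S, MeasurableSet S → κ () (S ×ˢ Set.univ) = ν S := by
    intro S hS
    rw [Kernel.const_apply, Measure.map_apply (by fun_prop) (hS.prod MeasurableSet.univ),
      Set.mk_preimage_prod_left (Set.mem_univ _)]
  have hle : κ.fst ≤ η := by
    refine fun _ => Measure.le_iff.mpr fun S hS => ?_
    rw [Kernel.fst_apply' _ _ hS, ← Set.preimage_ofPred_eq, Set.ofPred_mem_eq, ← Set.prod_univ]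
    exact (hκ S hS).trans_le (hνμ S)
  refine ⟨fun z => κ.density η () z Set.univ,
    Kernel.integrable_density hle () MeasurableSet.univ, fun S hS => ?_, ?_⟩
  · exact (Kernel.setIntegral_density hle () MeasurableSet.univ hS).trans
      (congrArg ENNReal.toReal (hκ S hS))
  · filter_upwards [Kernel.tendsto_m_density hle () MeasurableSet.univ] with z hz
    refine hz.congr fun k => ?_
    rw [Kernel.densityProcess, hκ _ (measurableSet_countablePartitionSet k z), ENNReal.toReal_div]
    rfl

theorem exists_tendsto_apply_of_norm_le {𝕜 E ι : Type*} [RCLike 𝕜] [NormedAddCommGroup E]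
    [NormedSpace 𝕜 E] (U : Ultrafilter ι) {a : ι → StrongDual 𝕜 E} {C : ℝ}
    (ha : ∀ i, ‖a i‖ ≤ C) :
    ∃ F : StrongDual 𝕜 E, ∀ x, Tendsto (fun i => a i x) U (𝓝 (F x)) := by
  obtain ⟨F, -, hF⟩ := (WeakDual.isCompact_closedBall (𝕜 := 𝕜) (E := E) 0 C).ultrafilter_le_nhds
    (U.map fun i => StrongDual.toWeakDual (a i))
    (le_principal_iff.mpr (Filter.mem_map.mpr <| univ_mem' fun i =>
      mem_closedBall_zero_iff.mpr (ha i)))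
  exact ⟨WeakDual.toStrongDual F, fun x => ((WeakDual.eval_continuous x).tendsto F).comp hF⟩

variable {X : Type*} [MeasurableSpace X] {H : Type*} [NormedAddCommGroup H]
  [InnerProductSpace ℂ H] [CompleteSpace H]

namespace GenMeasure

instance isFiniteMeasure_normMeasure (n : GenMeasure X H) : IsFiniteMeasure n.normMeasure :=
  ⟨by rw [n.normMeasure_apply MeasurableSet.univ]; exact ENNReal.ofReal_lt_top⟩

theorem normMeasure_real (n : GenMeasure X H) {S : Set X} (hS : MeasurableSet S) :
    n.normMeasure.real S = ‖n.vm S‖ := by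
  rw [Measure.real, n.normMeasure_apply hS, ENNReal.toReal_ofReal (norm_nonneg _)]

theorem ofReal_normMeasure_real (n : GenMeasure X H) {S : Set X} (hS : MeasurableSet S) :
    (n.normMeasure.real S : ℂ) = n.vm S 1 := by
  rw [n.normMeasure_real hS, norm_eq_of_positive (n.mem_genPositive S hS).2]

/-- The measure `S ↦ (B ↦ n(S)[C⋆ B C])`. -/
def conj (n : GenMeasure X H) (C : BOp H) : GenMeasure X H where
  vm := n.vm.mapRange
    (ContinuousLinearMap.precomp ℂ (ContinuousLinearMap.mul ℂ (BOp H) (star C) ∘L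
      (ContinuousLinearMap.mul ℂ (BOp H)).flip C)).toLinearMap.toAddMonoidHom
    (ContinuousLinearMap.continuous _)
  mem_genPositive S hS := mem_genPositive_iff.mpr
    (conjFunctional_nonneg (n.mem_genPositive S hS).2 C)

theorem conj_apply (n : GenMeasure X H) (C B : BOp H) (S : Set X) :
    (n.conj C).vm S B = n.vm S (star C * B * C) :=
  conjFunctional_apply (n.vm S) C B

theorem ofReal_normMeasure_conj_sqrt (n : GenMeasure X H) {B : BOp H} (hB : 0 ≤ B) {S : Set X}
    (hS : MeasurableSet S) : ((n.conj (CFC.sqrt B)).normMeasure.real S : ℂ) = n.vm S B := by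
  rw [ofReal_normMeasure_real _ hS, conj_apply, mul_one,
    (CFC.sqrt_nonneg B).isSelfAdjoint.star_eq, CFC.sqrt_mul_sqrt_self B hB]

theorem normMeasure_conj_sqrt_le (n : GenMeasure X H) {B : BOp H} (hB : 0 ≤ B) (hB1 : B ≤ 1) :
    (n.conj (CFC.sqrt B)).normMeasure ≤ n.normMeasure := by
  refine Measure.le_iff.mpr fun S hS => 
    (ENNReal.toReal_le_toReal (measure_ne_top _ S) (measure_ne_top _ S)).mp ?_
  change (n.conj (CFC.sqrt B)).normMeasure.real S ≤ n.normMeasure.real S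
  rw [← Complex.real_le_real, n.ofReal_normMeasure_conj_sqrt hB hS, n.ofReal_normMeasure_real hS,
    ← sub_nonneg, ← map_sub]
  exact (n.mem_genPositive S hS).2 _ (sub_nonneg.mpr hB1)

variable [CountablyGenerated X]

/-- The normalized functional `n(P) / ‖n(P)‖`, where `P` is the cell containing `z` of the `k`-th
partition in a refining sequence of countable partitions; it is zero on null cells. -/
def cellFunctional (n : GenMeasure X H) (z : X) (k : ℕ) : StrongDual ℂ (BOp H) :=
  ((‖n.vm (countablePartitionSet k z)‖⁻¹ : ℝ) : ℂ) • n.vm (countablePartitionSet k z)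

theorem norm_cellFunctional_le (n : GenMeasure X H) (z : X) (k : ℕ) :
    ‖n.cellFunctional z k‖ ≤ 1 := by
  rw [cellFunctional, norm_smul, Complex.norm_real, norm_inv, norm_norm]
  exact inv_mul_le_one

theorem cellFunctional_nonneg (n : GenMeasure X H) (z : X) (k : ℕ) {B : BOp H} (hB : 0 ≤ B) :
    0 ≤ n.cellFunctional z k B :=
  mul_nonneg (Complex.zero_le_real.mpr (inv_nonneg.mpr (norm_nonneg _)))
    ((n.mem_genPositive _ (measurableSet_countablePartitionSet k z)).2 B hB)

theorem cellFunctional_apply_of_nonneg (n : GenMeasure X H) (z : X) (k : ℕ) {B : BOp H}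
    (hB : 0 ≤ B) :
    n.cellFunctional z k B =
      (((n.conj (CFC.sqrt B)).normMeasure.real (countablePartitionSet k z) /
        n.normMeasure.real (countablePartitionSet k z) : ℝ) : ℂ) := by
  have hcell := measurableSet_countablePartitionSet k z
  rw [Complex.ofReal_div, n.ofReal_normMeasure_conj_sqrt hB hcell, n.normMeasure_real hcell,
    div_eq_inv_mul, ← Complex.ofReal_inv]
  rfl

/-- A weak-* limit of the normalized cell functionals at `z` along a fixed ultrafilter: a candidate
for the weak-* density of `n`. -/
def cellLimit (n : GenMeasure X H) (z : X) : StrongDual ℂ (BOp H) :=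
  (exists_tendsto_apply_of_norm_le (hyperfilter ℕ) (n.norm_cellFunctional_le z)).choose

theorem tendsto_cellFunctional (n : GenMeasure X H) (z : X) (B : BOp H) :
    Tendsto (fun k => n.cellFunctional z k B) (hyperfilter ℕ) (𝓝 (n.cellLimit z B)) :=
  (exists_tendsto_apply_of_norm_le (hyperfilter ℕ) (n.norm_cellFunctional_le z)).choose_spec B

theorem cellLimit_nonneg (n : GenMeasure X H) (z : X) {B : BOp H} (hB : 0 ≤ B) :
    0 ≤ n.cellLimit z B :=
  ge_of_tendsto' (n.tendsto_cellFunctional z B) fun k => n.cellFunctional_nonneg z k hB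

theorem cellLimit_density_of_le_one (n : GenMeasure X H) {B : BOp H} (hB : 0 ≤ B) (hB1 : B ≤ 1) :
    Integrable (fun z => n.cellLimit z B) n.normMeasure ∧
      ∀ S, MeasurableSet S → n.vm S B = ∫ z in S, n.cellLimit z B ∂n.normMeasure := by
  obtain ⟨f, hf, hfS, hlim⟩ :=
    exists_density_tendsto_countablePartitionSet (n.normMeasure_conj_sqrt_le hB hB1)
  have hae : (fun z => n.cellLimit z B) =ᵐ[n.normMeasure] fun z => (f z : ℂ) := by
    filter_upwards [hlim] with z hz
    refine tendsto_nhds_unique (n.tendsto_cellFunctional z B) ?_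
    simp only [n.cellFunctional_apply_of_nonneg z _ hB]
    exact ((Complex.continuous_ofReal.tendsto (f z)).comp hz).mono_left Nat.hyperfilter_le_atTop
  refine ⟨hf.ofReal.congr hae.symm, fun S hS => ?_⟩
  rw [integral_congr_ae (ae_restrict_of_ae hae), integral_complex_ofReal, hfS S hS,
    n.ofReal_normMeasure_conj_sqrt hB hS]

theorem cellLimit_density (n : GenMeasure X H) (B : BOp H) :
    Integrable (fun z => n.cellLimit z B) n.normMeasure ∧
      ∀ S, MeasurableSet S → n.vm S B = ∫ z in S, n.cellLimit z B ∂n.normMeasure := by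
  have hB : B ∈ Submodule.span ℂ ({B : BOp H | 0 ≤ B} ∩ Metric.closedBall 0 1) := by
    rw [CStarAlgebra.span_nonneg_inter_unitClosedBall]
    exact Submodule.mem_top
  induction hB using Submodule.span_induction with
  | mem B hB =>
    exact n.cellLimit_density_of_le_one hB.1
      ((CStarAlgebra.norm_le_one_iff_of_nonneg B hB.1).mp (mem_closedBall_zero_iff.mp hB.2))
  | zero => simp
  | add B C _ _ hB hC =>
    simp only [map_add]
    refine ⟨hB.1.add hC.1, fun S hS => ?_⟩
    rw [hB.2 S hS, hC.2 S hS, integral_add hB.1.integrableOn hC.1.integrableOn]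
  | smul c B _ hB =>
    simp only [map_smul, smul_eq_mul]
    refine ⟨hB.1.const_mul c, fun S hS => ?_⟩
    rw [hB.2 S hS, integral_const_mul]

theorem isWeakDensity_cellLimit (n : GenMeasure X H) : IsWeakDensity n n.cellLimit := by
  refine ⟨?_, n.cellLimit_density⟩
  have hone : (fun z => n.cellLimit z 1) =ᵐ[n.normMeasure] fun _ => (1 : ℂ) := by
    refine (n.cellLimit_density 1).1.ae_eq_of_forall_setIntegral_eq _ _ (integrable_const _)
      fun S hS _ => ?_
    rw [← (n.cellLimit_density 1).2 S hS, ← n.ofReal_normMeasure_real hS]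
    simp
  filter_upwards [hone] with z hz
  exact mem_genStates_iff.mpr ⟨fun B hB => n.cellLimit_nonneg z hB, hz⟩

end GenMeasure

end WeakDensity

section L1Functional

variable {X : Type*} [MeasurableSpace X] {E E' : Type*} [NormedAddCommGroup E]
  [NormedAddCommGroup E'] {μ ν : Measure X} {Φ Ψ : (X → E) → ℂ}

/-- An additive functional on the `μ`-integrable functions that is bounded for the `L¹` seminorm.
Its values on other functions are irrelevant. -/
structure IsL1Functional (μ : Measure X) (Φ : (X → E) → ℂ) : Prop where
  map_sub : ∀ f g, Integrable f μ → Integrable g μ → Φ (f - g) = Φ f - Φ g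
  exists_bound : ∃ C, 0 ≤ C ∧ ∀ f, Integrable f μ → ‖Φ f‖ ≤ C * ∫ x, ‖f x‖ ∂μ

namespace IsL1Functional

theorem map_add (hΦ : IsL1Functional μ Φ) {f g : X → E} (hf : Integrable f μ)
    (hg : Integrable g μ) : Φ (f + g) = Φ f + Φ g := by
  have hsub := hΦ.map_sub (f + g) g (hf.add hg) hg
  rw [add_sub_cancel_right] at hsub
  exact (sub_eq_iff_eq_add.mp hsub.symm)

theorem congr_ae (hΦ : IsL1Functional μ Φ) {f g : X → E} (hf : Integrable f μ)
    (hfg : f =ᵐ[μ] g) : Φ f = Φ g := by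
  obtain ⟨C, -, hC⟩ := hΦ.exists_bound
  have hbound := hC (f - g) (hf.sub (hf.congr hfg))
  rw [integral_eq_zero_of_ae (hfg.mono fun x hx => by simp [hx]), mul_zero,
    hΦ.map_sub f g hf (hf.congr hfg)] at hbound
  exact sub_eq_zero.mp (norm_le_zero_iff.mp hbound)

theorem continuous (hΦ : IsL1Functional μ Φ) : Continuous fun f : X →₁[μ] E => Φ f := by
  obtain ⟨C, -, hC⟩ := hΦ.exists_bound
  refine (LipschitzWith.of_dist_le' (K := C) fun f g => ?_).continuous
  rw [dist_eq_norm, dist_eq_norm, L1.norm_eq_integral_norm,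
    ← hΦ.map_sub _ _ (L1.integrable_coeFn f) (L1.integrable_coeFn g)]
  refine (hC _ ((L1.integrable_coeFn f).sub (L1.integrable_coeFn g))).trans_eq ?_
  congr 1
  exact integral_congr_ae ((Lp.coeFn_sub f g).mono fun x hx => (congrArg norm hx).symm)

theorem eq_of_forall_indicator_eq (hΦ : IsL1Functional μ Φ) (hΨ : IsL1Functional μ Ψ)
    (hind : ∀ (c : E) (S : Set X), MeasurableSet S →
      Φ (S.indicator fun _ => c) = Ψ (S.indicator fun _ => c))
    {f : X → E} (hf : Integrable f μ) : Φ f = Ψ f := by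
  refine Integrable.induction (fun f => Φ f = Ψ f) (fun c S hS _ => hind c S hS) ?_
    (isClosed_eq hΦ.continuous hΨ.continuous) ?_ hf
  · intro f g _ hf hg hΦΨf hΦΨg
    rw [hΦ.map_add hf hg, hΨ.map_add hf hg, hΦΨf, hΦΨg]
  · intro f g hfg hf hΦΨ
    rw [← hΦ.congr_ae hf hfg, ← hΨ.congr_ae hf hfg, hΦΨ]

theorem mono_measure (hΦ : IsL1Functional ν Φ) {c : ℝ≥0∞} (hc : c ≠ ⊤) (hνμ : ν ≤ c • μ) :
    IsL1Functional μ Φ := by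
  have hmono : ∀ {F : Type _} [NormedAddCommGroup F] {f : X → F}, Integrable f μ →
      Integrable f ν := fun hf => (hf.smul_measure hc).mono_measure hνμ
  obtain ⟨C, hC₀, hC⟩ := hΦ.exists_bound
  refine ⟨fun f g hf hg => hΦ.map_sub f g (hmono hf) (hmono hg), C * c.toReal, by positivity,
    fun f hf => (hC f (hmono hf)).trans ?_⟩
  rw [mul_assoc, ← smul_eq_mul c.toReal, ← integral_smul_measure]
  exact mul_le_mul_of_nonneg_left (integral_mono_measure hνμ
    (Eventually.of_forall fun _ => norm_nonneg _) (hf.norm.smul_measure hc)) hC₀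

theorem comp_clm {𝕜 : Type*} [NontriviallyNormedField 𝕜] [NormedSpace 𝕜 E] [NormedSpace 𝕜 E']
    (hΦ : IsL1Functional μ Φ) (L : E' →L[𝕜] E) :
    IsL1Functional μ fun f : X → E' => Φ fun x => L (f x) := by
  obtain ⟨C, hC₀, hC⟩ := hΦ.exists_bound
  refine ⟨fun f g hf hg => ?_, C * ‖L‖, by positivity, fun f hf => ?_⟩
  · rw [← hΦ.map_sub _ _ (L.integrable_comp hf) (L.integrable_comp hg)]
    congr 1
    ext x
    simp
  · refine (hC _ (L.integrable_comp hf)).trans ?_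
    rw [mul_assoc, ← integral_const_mul ‖L‖]
    exact mul_le_mul_of_nonneg_left (integral_mono (L.integrable_comp hf).norm
      (hf.norm.const_mul _) fun x => L.le_opNorm (f x)) hC₀

end IsL1Functional

end L1Functional

section Integration

variable {X : Type*} [MeasurableSpace X]

theorem aestronglyMeasurable_dual_apply {E : Type*} [NormedAddCommGroup E] [NormedSpace ℂ E]
    {μ : Measure X} {ρ : X → StrongDual ℂ E}
    (hρ : ∀ c, AEStronglyMeasurable (fun z => ρ z c) μ) {F : X → E}
    (hF : AEStronglyMeasurable F μ) : AEStronglyMeasurable (fun z => ρ z (F z)) μ := by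
  have hsimple : ∀ f : SimpleFunc X E, AEStronglyMeasurable (fun z => ρ z (f z)) μ := by
    intro f
    induction f using SimpleFunc.induction with
    | @const c S hS =>
      refine ((hρ c).indicator hS).congr (Eventually.of_forall fun z => ?_)
      by_cases hz : z ∈ S <;> simp [hz]
    | add _ hf hg => exact (hf.add hg).congr (Eventually.of_forall fun z => by simp)
  refine aestronglyMeasurable_of_tendsto_ae atTop
    (fun k => hsimple (hF.stronglyMeasurable_mk.approx k)) ?_
  filter_upwards [hF.ae_eq_mk] with z hz
  rw [hz]
  exact ((ρ z).continuous.tendsto _).comp (hF.stronglyMeasurable_mk.tendsto_approx z)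

variable {H : Type*} [NormedAddCommGroup H] [InnerProductSpace ℂ H] [CompleteSpace H]

namespace GenMeasure

variable (n : GenMeasure X H)

theorem isL1Functional_integral : IsL1Functional n.normMeasure n.integral := by
  refine ⟨fun f g hf hg => setToFun_sub n.dominated hf hg, 1, zero_le_one, fun f hf => ?_⟩
  refine (norm_setToFun_le n.dominated hf zero_le_one).trans_eq ?_
  rw [L1.norm_of_fun_eq_integral_norm]

theorem integral_indicator_const (B : BOp H) {S : Set X} (hS : MeasurableSet S) :
    n.integral (S.indicator fun _ => B) = n.vm S B :=
  setToFun_indicator_const n.dominated hS (measure_ne_top _ _) B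

theorem integral_const (B : BOp H) : n.integral (fun _ => B) = n.vm Set.univ B := by
  rw [← n.integral_indicator_const B MeasurableSet.univ, Set.indicator_univ]

end GenMeasure

theorem norm_apply_le_of_mem_genStates {ρ : StrongDual ℂ (BOp H)} (hρ : ρ ∈ genStates H)
    (B : BOp H) : ‖ρ B‖ ≤ ‖B‖ := by
  simpa [hρ.2] using ρ.le_opNorm B

namespace IsWeakDensity

variable {n : GenMeasure X H} {ρ : X → StrongDual ℂ (BOp H)}

theorem integrable (h : IsWeakDensity n ρ) {F : X → BOp H} (hF : Integrable F n.normMeasure) :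
    Integrable (fun z => ρ z (F z)) n.normMeasure :=
  hF.norm.mono'
    (aestronglyMeasurable_dual_apply (fun B => (h.2 B).1.aestronglyMeasurable) hF.1)
    (h.1.mono fun _ hz => norm_apply_le_of_mem_genStates hz _)

theorem isL1Functional (h : IsWeakDensity n ρ) :
    IsL1Functional n.normMeasure fun F : X → BOp H => ∫ z, ρ z (F z) ∂n.normMeasure := by
  refine ⟨fun F G hF hG => ?_, 1, zero_le_one, fun F hF => ?_⟩
  · simp only [Pi.sub_apply, map_sub]
    exact integral_sub (h.integrable hF) (h.integrable hG)
  · rw [one_mul]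
    exact norm_integral_le_of_norm_le hF.norm
      (h.1.mono fun _ hz => norm_apply_le_of_mem_genStates hz _)

theorem integral_eq (h : IsWeakDensity n ρ) {F : X → BOp H} (hF : Integrable F n.normMeasure) :
    n.integral F = ∫ z, ρ z (F z) ∂n.normMeasure := by
  refine n.isL1Functional_integral.eq_of_forall_indicator_eq h.isL1Functional
    (fun B S hS => ?_) hF
  rw [n.integral_indicator_const B hS, (h.2 B).2 S hS, ← integral_indicator hS]
  refine integral_congr_ae (Eventually.of_forall fun z => ?_)
  by_cases hz : z ∈ S <;> simp [hz]

theorem ae_apply_nonneg (h : IsWeakDensity n ρ) {D : X → BOp H} (hD : ∀ z, 0 ≤ D z) :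
    ∀ᵐ z ∂n.normMeasure, 0 ≤ ρ z (D z) :=
  h.1.mono fun z hz => (mem_genStates_iff.mp hz).1 _ (hD z)

theorem ae_apply_eq_zero (h : IsWeakDensity n ρ) {D : X → BOp H} (hD : ∀ z, 0 ≤ D z)
    (hDi : Integrable D n.normMeasure) (h0 : n.integral D = 0) :
    ∀ᵐ z ∂n.normMeasure, ρ z (D z) = 0 := by
  have hre : ∫ z, (ρ z (D z)).re ∂n.normMeasure = 0 := by
    have hre := integral_re (h.integrable hDi)
    rwa [← h.integral_eq hDi, h0] at hre
  rw [integral_eq_zero_iff_of_nonneg_ae ((h.ae_apply_nonneg hD).mono fun z hz =>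
    (Complex.nonneg_iff.mp hz).1) (h.integrable hDi).re] at hre
  filter_upwards [hre, h.ae_apply_nonneg hD] with z hz hz₀
  exact Complex.ext hz (Complex.nonneg_iff.mp hz₀).2.symm

end IsWeakDensity

theorem GenMeasure.integral_nonneg [MeasurableSpace.CountablyGenerated X] (n : GenMeasure X H)
    {D : X → BOp H} (hD : ∀ z, 0 ≤ D z) (hDi : Integrable D n.normMeasure) : 0 ≤ n.integral D := by
  rw [n.isWeakDensity_cellLimit.integral_eq hDi]
  exact integral_nonneg_of_ae (n.isWeakDensity_cellLimit.ae_apply_nonneg hD)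

end Integration

section Lift

variable {H : Type*} [NormedAddCommGroup H] [InnerProductSpace ℂ H] [CompleteSpace H]
  {Q : Type*} [NormedAddCommGroup Q] [InnerProductSpace ℂ Q] [CompleteSpace Q]
  {X : Type*} [MeasurableSpace X] {J : Q →L[ℂ] H} {n nT : GenMeasure X H}

namespace IsLift

theorem normMeasure_le (hL : IsLift J n nT) :
    n.normMeasure ≤ ENNReal.ofReal ‖invSqrtT J * invSqrtT J‖ • nT.normMeasure := by
  refine Measure.le_iff.mpr fun S hS => ?_
  rw [Measure.smul_apply, smul_eq_mul, n.normMeasure_apply hS, nT.normMeasure_apply hS,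
    ← ENNReal.ofReal_mul (norm_nonneg _), n.norm_apply_eq hS, ← hL S hS 1, mul_one]
  refine ENNReal.ofReal_le_ofReal ((Complex.re_le_norm _).trans ?_)
  rw [mul_comm]
  exact (nT.vm S).le_opNorm _

theorem integrable (hL : IsLift J n nT) {E : Type*} [NormedAddCommGroup E] {F : X → E}
    (hF : Integrable F nT.normMeasure) : Integrable F n.normMeasure :=
  (hF.smul_measure ENNReal.ofReal_ne_top).mono_measure hL.normMeasure_le

theorem integral_eq (hL : IsLift J n nT) {F : X → BOp H} (hF : Integrable F nT.normMeasure) :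
    n.integral F = nT.integral fun z => invSqrtT J * F z * invSqrtT J := by
  let conjR : BOp H →L[ℂ] BOp H :=
    (ContinuousLinearMap.mul ℂ (BOp H)).flip (invSqrtT J) ∘L
      ContinuousLinearMap.mul ℂ (BOp H) (invSqrtT J)
  refine (n.isL1Functional_integral.mono_measure ENNReal.ofReal_ne_top
    hL.normMeasure_le).eq_of_forall_indicator_eq (nT.isL1Functional_integral.comp_clm conjR)
    (fun B S hS => ?_) hF
  rw [n.integral_indicator_const B hS, ← hL S hS B, ← nT.integral_indicator_const _ hS]
  congr 1
  ext1 z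
  by_cases hz : z ∈ S <;> simp [hz, conjR]

end IsLift

end Lift

section Dirac

variable {X : Type*} [MeasurableSpace X] {H : Type*} [NormedAddCommGroup H]
  [InnerProductSpace ℂ H]

namespace GenMeasure

/-- The generalized state-valued measure with mass `ρ` at the point `z`. -/
def dirac (z : X) {ρ : StrongDual ℂ (BOp H)} (hρ : ρ ∈ genPositive H) : GenMeasure X H where
  vm := VectorMeasure.dirac z ρ
  mem_genPositive S hS := by
    by_cases hz : z ∈ S
    · rwa [VectorMeasure.dirac_apply_of_mem hS hz]
    · rw [VectorMeasure.dirac_apply_of_notMem hz]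
      exact mem_genPositive_iff.mpr fun _ _ => le_rfl

variable (z : X) {ρ : StrongDual ℂ (BOp H)} (hρ : ρ ∈ genPositive H)

theorem dirac_univ : (dirac z hρ).vm Set.univ = ρ :=
  VectorMeasure.dirac_apply_of_mem MeasurableSet.univ (Set.mem_univ z)

variable [MeasurableSingletonClass X] [CompleteSpace H]

theorem ae_dirac : ∀ᵐ y ∂(dirac z hρ).normMeasure, y = z := by
  rw [ae_iff]
  change (dirac z hρ).normMeasure {z}ᶜ = 0
  rw [normMeasure_apply _ (MeasurableSet.singleton z).compl]
  change ENNReal.ofReal ‖VectorMeasure.dirac z ρ {z}ᶜ‖ = 0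
  rw [VectorMeasure.dirac_apply_of_notMem (by simp)]
  simp

theorem ae_eq_const_dirac (F : X → BOp H) :
    F =ᵐ[(dirac z hρ).normMeasure] fun _ => F z :=
  (ae_dirac z hρ).mono fun y hy => by rw [hy]

theorem integrable_dirac (F : X → BOp H) : Integrable F (dirac z hρ).normMeasure :=
  (integrable_const (F z)).congr (ae_eq_const_dirac z hρ F).symm

theorem integral_dirac (F : X → BOp H) : (dirac z hρ).integral F = ρ (F z) := by
  rw [(isL1Functional_integral _).congr_ae (integrable_dirac z hρ F) (ae_eq_const_dirac z hρ F),
    integral_const, dirac_univ]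

end GenMeasure

end Dirac

section SquareRoot

variable {H : Type*} [NormedAddCommGroup H] [InnerProductSpace ℂ H] [CompleteSpace H]

theorem le_iff_forall_re_inner_le {A B : BOp H} (hA : IsSelfAdjoint A) (hB : IsSelfAdjoint B) :
    A ≤ B ↔ ∀ f, (inner ℂ f (A f)).re ≤ (inner ℂ f (B f)).re := by
  rw [ContinuousLinearMap.le_def, ContinuousLinearMap.isPositive_def', and_iff_right (hB.sub hA)]
  refine forall_congr' fun f => ?_
  rw [ContinuousLinearMap.reApplyInnerSelf_apply, inner_re_symm, sub_apply, inner_sub_right,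
    map_sub, sub_nonneg]
  rfl

theorem re_inner_mul_self {R : BOp H} (hR : IsSelfAdjoint R) (f : H) :
    (inner ℂ f ((R * R) f)).re = ‖R f‖ ^ 2 := by
  have hsymm : inner ℂ (R f) (R f) = inner ℂ f (R (R f)) := hR.isSymmetric f (R f)
  rw [mul_apply_eq_comp, ← hsymm]
  exact inner_self_eq_norm_sq (𝕜 := ℂ) (R f)

variable {Q : Type*} [NormedAddCommGroup Q] [InnerProductSpace ℂ Q] [CompleteSpace Q]
  (J : Q →L[ℂ] H)

theorem invSqrtT_mul_self : invSqrtT J * invSqrtT J = invT J :=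
  CFC.sqrt_mul_sqrt_self _ ((ContinuousLinearMap.nonneg_iff_isPositive _).mpr
    (ContinuousLinearMap.isPositive_self_comp_adjoint J))

theorem isSelfAdjoint_invSqrtT : IsSelfAdjoint (invSqrtT J) :=
  (CFC.sqrt_nonneg (invT J)).isSelfAdjoint

theorem invSqrtT_invSqrtT (f : H) :
    invSqrtT J (invSqrtT J f) = J (ContinuousLinearMap.adjoint J f) :=
  congrArg (fun B : BOp H => B f) (invSqrtT_mul_self J)

theorem norm_invSqrtT_apply (f : H) : ‖invSqrtT J f‖ = ‖ContinuousLinearMap.adjoint J f‖ := by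
  rw [← sq_eq_sq₀ (norm_nonneg _) (norm_nonneg _), ← re_inner_mul_self (isSelfAdjoint_invSqrtT J),
    invSqrtT_mul_self, invT, ContinuousLinearMap.comp_apply,
    ← ContinuousLinearMap.adjoint_inner_left]
  exact inner_self_eq_norm_sq (𝕜 := ℂ) _

variable {J}

theorem injective_invSqrtT (hJ : DenseRange J) : Function.Injective (invSqrtT J) := by
  refine (injective_iff_map_eq_zero _).mpr fun f hf => ?_
  have hadj : ContinuousLinearMap.adjoint J f = 0 := by
    rw [← norm_eq_zero, ← norm_invSqrtT_apply, hf, norm_zero]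
  refine hJ.eq_zero_of_inner_left ℂ fun u => ?_
  rw [← ContinuousLinearMap.adjoint_inner_left, hadj, inner_zero_left]

theorem denseRange_invSqrtT (hJ : DenseRange J) : DenseRange (invSqrtT J) := by
  refine (Submodule.dense_iff_topologicalClosure_eq_top (s := (invSqrtT J).range)).mpr ?_
  rw [Submodule.topologicalClosure_eq_top_iff, ContinuousLinearMap.orthogonal_range,
    (isSelfAdjoint_invSqrtT J).adjoint_eq]
  exact LinearMap.ker_eq_bot.mpr (injective_invSqrtT hJ)

/-- `T^{-1/2}` as an isometry `H → Q`: it extends `T^{-1/2} f ↦ T⁻¹ f`. -/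
def isometricFactor (J : Q →L[ℂ] H) : H →L[ℂ] Q :=
  (ContinuousLinearMap.adjoint J).toLinearMap.extendOfNorm (invSqrtT J).toLinearMap

theorem isometricFactor_invSqrtT (hJ : DenseRange J) (f : H) :
    isometricFactor J (invSqrtT J f) = ContinuousLinearMap.adjoint J f :=
  LinearMap.extendOfNorm_eq (denseRange_invSqrtT hJ)
    ⟨1, fun f => by rw [one_mul]; exact (norm_invSqrtT_apply J f).ge⟩ f

theorem apply_isometricFactor (hJ : DenseRange J) (f : H) :
    J (isometricFactor J f) = invSqrtT J f := by
  refine (denseRange_invSqrtT hJ).induction_on f (isClosed_eq (by fun_prop) (by fun_prop))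
    fun g => ?_
  rw [isometricFactor_invSqrtT hJ, invSqrtT_invSqrtT]

theorem norm_isometricFactor (hJ : DenseRange J) (f : H) : ‖isometricFactor J f‖ = ‖f‖ := by
  refine (denseRange_invSqrtT hJ).induction_on f (isClosed_eq (by fun_prop) (by fun_prop))
    fun g => ?_
  rw [isometricFactor_invSqrtT hJ, norm_invSqrtT_apply]

/-- The operator `T^{-1/2} 𝓕 T^{-1/2}`, where the form `𝓕` is represented by `S` on `Q`. -/
def sandwich (J : Q →L[ℂ] H) (S : Q →L[ℂ] Q) : BOp H :=
  ContinuousLinearMap.adjoint (isometricFactor J) ∘L S ∘L isometricFactor J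

theorem inner_sandwich (S : Q →L[ℂ] Q) (f g : H) :
    inner ℂ f (sandwich J S g) = inner ℂ (isometricFactor J f) (S (isometricFactor J g)) := by
  rw [sandwich, ContinuousLinearMap.comp_apply, ContinuousLinearMap.comp_apply,
    ContinuousLinearMap.adjoint_inner_right]

theorem isSelfAdjoint_sandwich {S : Q →L[ℂ] Q} (hS : IsSelfAdjoint S) :
    IsSelfAdjoint (sandwich J S) :=
  hS.adjoint_conj (isometricFactor J)

theorem isSandwich_iff (hinj : Function.Injective J) (hJ : DenseRange J) {S : Q →L[ℂ] Q}
    {B : BOp H} : IsSandwich J (fun u v => inner ℂ u (S v)) B ↔ B = sandwich J S := by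
  constructor
  · intro hB
    refine ContinuousLinearMap.ext fun g => ext_inner_left ℂ fun f => ?_
    rw [inner_sandwich, hB f g _ _ (apply_isometricFactor hJ f) (apply_isometricFactor hJ g)]
  · rintro rfl f g u v hu hv
    rw [inner_sandwich, hinj (hu.trans (apply_isometricFactor hJ f).symm),
      hinj (hv.trans (apply_isometricFactor hJ g).symm)]

theorem smul_one_le_sandwich_add (hJ : DenseRange J) {S : Q →L[ℂ] Q} (hS : IsSelfAdjoint S)
    {δ C : ℝ} (hδ : ∀ u, δ * ‖u‖ ^ 2 ≤ (inner ℂ u (S u)).re + C * ‖J u‖ ^ 2) :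
    δ • (1 : BOp H) ≤ sandwich J S + C • (invSqrtT J * invSqrtT J) := by
  have hR := isSelfAdjoint_invSqrtT J
  rw [le_iff_forall_re_inner_le (.smul (.all δ) (.one _))
    ((isSelfAdjoint_sandwich hS).add (.smul (.all C) hR.mul_self_nonneg.isSelfAdjoint))]
  intro f
  have hone : (inner ℂ f f).re = ‖f‖ ^ 2 := inner_self_eq_norm_sq (𝕜 := ℂ) f
  rw [add_apply, smul_apply, smul_apply, inner_add_right, Complex.add_re, inner_smul_right_eq_smul,
    inner_smul_right_eq_smul, Complex.smul_re, Complex.smul_re, re_inner_mul_self hR,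
    inner_sandwich, one_apply_eq_self, hone, ← norm_isometricFactor hJ f,
    ← apply_isometricFactor hJ f]
  exact hδ _

end SquareRoot

theorem aestronglyMeasurable_inverse {X 𝕄 : Type*} [MeasurableSpace X] {μ : Measure X}
    [NormedRing 𝕄] [HasSummableGeomSeries 𝕄] {M : X → 𝕄} (hM : AEStronglyMeasurable M μ)
    (hu : ∀ z, IsUnit (M z)) : AEStronglyMeasurable (fun z => Ring.inverse (M z)) μ := by
  refine aestronglyMeasurable_of_tendsto_ae atTop
    (f := fun k z => ((hM.stronglyMeasurable_mk.approx k).map Ring.inverse) z)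
    (fun k => (SimpleFunc.stronglyMeasurable _).aestronglyMeasurable) ?_
  filter_upwards [hM.ae_eq_mk] with z hz
  obtain ⟨m, hm⟩ := hu z
  have hcont : ContinuousAt Ring.inverse (hM.mk M z) := by
    rw [← hz, ← hm]
    exact NormedRing.inverse_continuousAt m
  rw [hz]
  exact hcont.tendsto.comp (hM.stronglyMeasurable_mk.tendsto_approx z)

section Equivalence

variable {H : Type*} [NormedAddCommGroup H] [InnerProductSpace ℂ H] [CompleteSpace H]
  {Q : Type*} [NormedAddCommGroup Q] [InnerProductSpace ℂ Q] [CompleteSpace Q]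
  {X : Type*} {J : Q →L[ℂ] H} {a : X → Q → Q → ℂ} {A : X → BOp H}

/-- The operators `A z = T^{-1/2} ℋ_z T^{-1/2}` exist, and `ℋ_z ≥ δ T - C` for some `δ > 0` and
`C` depending on `z`. -/
structure IsCoerciveSandwich (J : Q →L[ℂ] H) (a : X → Q → Q → ℂ) (A : X → BOp H) : Prop where
  isSandwich_iff : ∀ z B, IsSandwich J (a z) B ↔ B = A z
  isSelfAdjoint : ∀ z, IsSelfAdjoint (A z)
  coercive : ∀ z, ∃ δ > (0 : ℝ), ∃ C : ℝ,
    δ • (1 : BOp H) ≤ A z + C • (invSqrtT J * invSqrtT J)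

/-- The operator `T^{-1/2} (ℋ_z - E) T^{-1/2}`, where `A z = T^{-1/2} ℋ_z T^{-1/2}`. -/
def shifted (J : Q →L[ℂ] H) (A : X → BOp H) (E : ℝ) (z : X) : BOp H :=
  A z - E • (invSqrtT J * invSqrtT J)

/-- The resolvent `(ℋ_z - E + 1)⁻¹`, where `A z = T^{-1/2} ℋ_z T^{-1/2}`. -/
def shiftedResolvent (J : Q →L[ℂ] H) (A : X → BOp H) (E : ℝ) (z : X) : BOp H :=
  formResolvent (invSqrtT J) (shifted J A E z)

theorem apply_shifted_eq_zero_iff {ρT : StrongDual ℂ (BOp H)}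
    (h1 : ρT (invSqrtT J * invSqrtT J) = 1) {E : ℝ} {z : X} :
    ρT (shifted J A E z) = 0 ↔ ρT (A z) = E := by
  rw [shifted, map_sub, ContinuousLinearMap.map_smul_of_tower, h1, sub_eq_zero, Complex.real_smul,
    mul_one]

theorem gqcInf_anti {𝒮 𝒮' : Set (StrongDual ℂ (BOp H))} (h : 𝒮 ⊆ 𝒮') :
    gqcInf J a 𝒮' ≤ gqcInf J a 𝒮 :=
  sInf_le_sInf fun _ ⟨ρ, hρ, henergy⟩ => ⟨ρ, h hρ, henergy⟩

namespace IsCoerciveSandwich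

theorem isSandwich (hA : IsCoerciveSandwich J a A) (z : X) : IsSandwich J (a z) (A z) :=
  (hA.isSandwich_iff z _).mpr rfl

theorem eq_of_isSandwich (hA : IsCoerciveSandwich J a A) {A' : X → BOp H}
    (hA' : ∀ z, IsSandwich J (a z) (A' z)) : A' = A :=
  funext fun z => (hA.isSandwich_iff z _).mp (hA' z)

theorem isUnit (hA : IsCoerciveSandwich J a A) {E : ℝ} {z : X} (hG : 0 ≤ shifted J A E z) :
    IsUnit (shifted J A E z + invSqrtT J * invSqrtT J) := by
  obtain ⟨δ, hδ, C, hle⟩ := hA.coercive z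
  refine isUnit_add_mul_self (isSelfAdjoint_invSqrtT J) hG hδ (C := C + E) ?_
  rwa [shifted, add_comm C, add_smul, ← add_assoc, sub_add_cancel]

theorem shifted_nonneg_iff (hA : IsCoerciveSandwich J a A) {c : ℝ} {z : X} :
    0 ≤ shifted J A c z ↔ ∀ f, c * ‖invSqrtT J f‖ ^ 2 ≤ (inner ℂ f (A z f)).re := by
  have hR := isSelfAdjoint_invSqrtT J
  rw [shifted, sub_nonneg, le_iff_forall_re_inner_le
    (.smul (.all c) hR.mul_self_nonneg.isSelfAdjoint) (hA.isSelfAdjoint z)]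
  refine forall_congr' fun f => ?_
  rw [smul_apply, inner_smul_right_eq_smul, Complex.smul_re, re_inner_mul_self hR, smul_eq_mul]

theorem isGqcEnergy_vecFunctional (hA : IsCoerciveSandwich J a A) (f : H) (z : X) :
    IsGqcEnergy J a (vecFunctional (invSqrtT J f) (invSqrtT J f)) z (inner ℂ f (A z f)).re := by
  refine ⟨vecFunctional f f, mem_genPositive_iff.mpr (vecFunctional_self_nonneg f), fun B => ?_,
    A z, hA.isSandwich z, ?_⟩
  · exact ((isSelfAdjoint_invSqrtT J).isSymmetric f (B (invSqrtT J f))).symm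
  · exact ((hA.isSelfAdjoint z).isSymmetric.coe_re_inner_self_apply f).symm

theorem shifted_nonneg (hA : IsCoerciveSandwich J a A) (hJ : DenseRange J) {c : ℝ}
    (hc : (c : EReal) ≤ gqcInf J a (genPureStates H)) (z : X) : 0 ≤ shifted J A c z := by
  have hunit : ∀ f, ‖invSqrtT J f‖ = 1 → c ≤ (inner ℂ f (A z f)).re := fun f hf =>
    EReal.coe_le_coe_iff.mp (hc.trans (sInf_le ⟨_, vecFunctional_mem_genPureStates hf, z, _,
      hA.isGqcEnergy_vecFunctional f z, rfl⟩))
  refine hA.shifted_nonneg_iff.mpr fun f => ?_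
  rcases eq_or_ne f 0 with rfl | hf
  · simp
  have hpos : 0 < ‖invSqrtT J f‖ :=
    norm_pos_iff.mpr ((map_ne_zero_iff _ (injective_invSqrtT hJ)).mpr hf)
  have hnormalized := hunit (‖invSqrtT J f‖⁻¹ • f) (by
    rw [ContinuousLinearMap.map_smul_of_tower, norm_smul, norm_inv, norm_norm,
      inv_mul_cancel₀ hpos.ne'])
  rw [ContinuousLinearMap.map_smul_of_tower, inner_smul_left_eq_smul, inner_smul_right_eq_smul,
    smul_smul, Complex.smul_re, smul_eq_mul, ← mul_inv, ← sq, ← div_eq_inv_mul,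
    le_div_iff₀ (by positivity)] at hnormalized
  exact hnormalized

theorem apply_shiftedResolvent_eq_one (hA : IsCoerciveSandwich J a A) {E : ℝ} {z : X}
    (hG : 0 ≤ shifted J A E z) {ρ : StrongDual ℂ (BOp H)} (hρ : ρ ∈ genStates H)
    (henergy : IsGqcEnergy J a ρ z E) : ρ (shiftedResolvent J A E z) = 1 := by
  obtain ⟨ρT, hρT, hlift, B, hB, hBE⟩ := henergy
  obtain rfl := (hA.isSandwich_iff z B).mp hB
  have hone : ρT (invSqrtT J * invSqrtT J) = 1 := by
    rw [← (mem_genStates_iff.mp hρ).2, ← hlift 1, mul_one]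
  rw [← hlift, shiftedResolvent, map_mul_formResolvent_mul hG (hA.isUnit hG)
    (mem_genPositive_iff.mp hρT) ((apply_shifted_eq_zero_iff hone).mpr hBE), hone]

theorem isGqcEnergy_of_apply_shiftedResolvent (hA : IsCoerciveSandwich J a A) {E : ℝ} {z : X}
    (hG : 0 ≤ shifted J A E z) {ρ : StrongDual ℂ (BOp H)} (hρ : ρ ∈ genStates H)
    (hK : ρ (shiftedResolvent J A E z) = 1) : IsGqcEnergy J a ρ z E := by
  obtain ⟨hpos, hone⟩ := mem_genStates_iff.mp hρ
  have hR := isSelfAdjoint_invSqrtT J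
  have hK' := hK.trans hone.symm
  have hlift := conjFunctional_apply_conjugate hR hG (hA.isUnit hG) hpos hK'
  refine ⟨_, mem_genPositive_iff.mpr fun B hB => conjFunctional_nonneg hpos _ B hB, hlift,
    A z, hA.isSandwich z, (apply_shifted_eq_zero_iff ?_).mp
      (conjFunctional_apply_eq_zero hR hG (hA.isUnit hG) hpos hK')⟩
  rw [← hone, ← hlift 1, mul_one]

end IsCoerciveSandwich

variable [MeasurableSpace X] {n nT : GenMeasure X H}

theorem IsLift.apply_univ_invSqrtT_mul_self (hL : IsLift J n nT) (hn : ‖n.vm Set.univ‖ = 1) :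
    nT.vm Set.univ (invSqrtT J * invSqrtT J) = 1 := by
  have hone := hL Set.univ MeasurableSet.univ 1
  rw [mul_one] at hone
  rw [hone, ← norm_eq_of_positive (n.mem_genPositive _ MeasurableSet.univ).2, hn,
    Complex.ofReal_one]

theorem integrable_shifted (hi : Integrable A nT.normMeasure) (E : ℝ) :
    Integrable (shifted J A E) nT.normMeasure :=
  hi.sub (integrable_const _)

theorem IsLift.integral_shifted (hL : IsLift J n nT) (hn : ‖n.vm Set.univ‖ = 1)
    (hi : Integrable A nT.normMeasure) (E : ℝ) :
    nT.integral (shifted J A E) = nT.integral A - E := by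
  have hsub := nT.isL1Functional_integral.map_sub A (fun _ => E • (invSqrtT J * invSqrtT J)) hi
    (integrable_const _)
  rwa [nT.integral_const, ContinuousLinearMap.map_smul_of_tower,
    hL.apply_univ_invSqrtT_mul_self hn, Complex.real_smul, mul_one] at hsub

theorem IsLift.dirac (z : X) {ρ ρT : StrongDual ℂ (BOp H)} (hρ : ρ ∈ genPositive H)
    (hρT : ρT ∈ genPositive H) (hlift : ∀ B : BOp H, ρT (invSqrtT J * B * invSqrtT J) = ρ B) :
    IsLift J (GenMeasure.dirac z hρ) (GenMeasure.dirac z hρT) := by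
  intro S hS B
  change VectorMeasure.dirac z ρT S _ = VectorMeasure.dirac z ρ S _
  by_cases hz : z ∈ S
  · rw [VectorMeasure.dirac_apply_of_mem hS hz, VectorMeasure.dirac_apply_of_mem hS hz, hlift]
  · rw [VectorMeasure.dirac_apply_of_notMem hz, VectorMeasure.dirac_apply_of_notMem hz]
    rfl

namespace IsCoerciveSandwich

theorem isGsvmEnergy_dirac [MeasurableSingletonClass X] (hA : IsCoerciveSandwich J a A)
    {ρ : StrongDual ℂ (BOp H)} (hρ : ρ ∈ genPositive H) {z : X} {e : ℝ}
    (he : IsGqcEnergy J a ρ z e) : IsGsvmEnergy J a (GenMeasure.dirac z hρ) e := by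
  obtain ⟨ρT, hρT, hlift, B, hB, hBe⟩ := he
  obtain rfl := (hA.isSandwich_iff z B).mp hB
  exact ⟨_, .dirac z hρ hρT hlift, A, hA.isSandwich, GenMeasure.integrable_dirac z hρT A,
    (GenMeasure.integral_dirac z hρT A).trans hBe⟩

theorem gsvmInf_le_gqcInf [MeasurableSingletonClass X] (hA : IsCoerciveSandwich J a A) :
    gsvmInf J a ≤ gqcInf J a (genStates H) := by
  refine le_sInf ?_
  rintro _ ⟨ρ, hρ, z, e, he, rfl⟩
  refine sInf_le ⟨GenMeasure.dirac z hρ.1, ?_, e, hA.isGsvmEnergy_dirac hρ.1 he, rfl⟩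
  rw [GenMeasure.dirac_univ, hρ.2]

theorem integrable_shiftedResolvent (hA : IsCoerciveSandwich J a A)
    (hi : Integrable A nT.normMeasure) {E : ℝ} (hG : ∀ z, 0 ≤ shifted J A E z) :
    Integrable (shiftedResolvent J A E) nT.normMeasure := by
  refine Integrable.of_bound ?_ 1 (Eventually.of_forall fun z =>
    norm_formResolvent_le_one (isSelfAdjoint_invSqrtT J) (hG z) (hA.isUnit (hG z)))
  have hmeas : AEStronglyMeasurable (fun z => shifted J A E z + invSqrtT J * invSqrtT J)
      nT.normMeasure :=
    (integrable_shifted hi E).aestronglyMeasurable.add aestronglyMeasurable_const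
  exact ((aestronglyMeasurable_inverse hmeas fun z => hA.isUnit (hG z)).const_mul _).mul_const _

variable [MeasurableSpace.CountablyGenerated X]

theorem le_gsvmInf (hA : IsCoerciveSandwich J a A) {c : ℝ} (hc : ∀ z, 0 ≤ shifted J A c z) :
    (c : EReal) ≤ gsvmInf J a := by
  refine le_sInf ?_
  rintro _ ⟨n, hn, e, ⟨nT, hL, A', hA', hi, he⟩, rfl⟩
  obtain rfl := hA.eq_of_isSandwich hA'
  have hnonneg := nT.integral_nonneg hc (integrable_shifted hi c)
  rw [hL.integral_shifted hn hi, he, sub_nonneg] at hnonneg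
  exact_mod_cast hnonneg

theorem integral_one_sub_shiftedResolvent (hA : IsCoerciveSandwich J a A) (hL : IsLift J n nT)
    (hi : Integrable A nT.normMeasure) {E : ℝ} (hG : ∀ z, 0 ≤ shifted J A E z)
    (h0 : nT.integral (shifted J A E) = 0) :
    n.integral (fun z => 1 - shiftedResolvent J A E z) = 0 := by
  have hρT := nT.isWeakDensity_cellLimit
  have hKi := (integrable_const (1 : BOp H)).sub (hA.integrable_shiftedResolvent hi hG)
  have hKi' : Integrable (fun z => invSqrtT J * (1 - shiftedResolvent J A E z) * invSqrtT J)
      nT.normMeasure := (hKi.const_mul _).mul_const _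
  refine (hL.integral_eq hKi).trans ((hρT.integral_eq hKi').trans (integral_eq_zero_of_ae ?_))
  filter_upwards [hρT.ae_apply_eq_zero hG (integrable_shifted hi E) h0, hρT.1] with z hz hstate
  rw [mul_sub, sub_mul, mul_one, map_sub, shiftedResolvent, map_mul_formResolvent_mul (hG z)
    (hA.isUnit (hG z)) (mem_genStates_iff.mp hstate).1 hz, sub_self, Pi.zero_apply]

theorem ae_apply_shiftedResolvent_eq_one (hA : IsCoerciveSandwich J a A)
    (hn : ‖n.vm Set.univ‖ = 1) {E : ℝ} (hG : ∀ z, 0 ≤ shifted J A E z)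
    (henergy : IsGsvmEnergy J a n E) {ρ : X → StrongDual ℂ (BOp H)} (hρ : IsWeakDensity n ρ) :
    ∀ᵐ z ∂n.normMeasure, ρ z (shiftedResolvent J A E z) = 1 := by
  obtain ⟨nT, hL, A', hA', hi, he⟩ := henergy
  obtain rfl := hA.eq_of_isSandwich hA'
  have h0 : nT.integral (shifted J A' E) = 0 := by rw [hL.integral_shifted hn hi, he, sub_self]
  have hle : ∀ z, 0 ≤ 1 - shiftedResolvent J A' E z := fun z => sub_nonneg.mpr
    (formResolvent_le_one (isSelfAdjoint_invSqrtT J) (hG z) (hA.isUnit (hG z)))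
  have hKi := (integrable_const (1 : BOp H)).sub
    (hL.integrable (hA.integrable_shiftedResolvent hi hG))
  filter_upwards [hρ.ae_apply_eq_zero hle hKi
    (hA.integral_one_sub_shiftedResolvent hL hi hG h0), hρ.1] with z hz hstate
  rw [map_sub, (mem_genStates_iff.mp hstate).2, sub_eq_zero] at hz
  exact hz.symm

theorem gqcInf_genPureStates_le (hA : IsCoerciveSandwich J a A) (hJ : DenseRange J) :
    gqcInf J a (genPureStates H) ≤ gsvmInf J a := by
  refine EReal.ge_of_forall_gt_iff_ge.mp fun c hc => ?_
  exact hA.le_gsvmInf (hA.shifted_nonneg hJ hc.le)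

variable [MeasurableSingletonClass X]

theorem gqcInf_genStates_eq (hA : IsCoerciveSandwich J a A) (hJ : DenseRange J) :
    gqcInf J a (genStates H) = gsvmInf J a :=
  ((gqcInf_anti extremePoints_subset).trans (hA.gqcInf_genPureStates_le hJ)).antisymm
    hA.gsvmInf_le_gqcInf

theorem gqcInf_genPureStates_eq (hA : IsCoerciveSandwich J a A) (hJ : DenseRange J) :
    gqcInf J a (genPureStates H) = gsvmInf J a :=
  (hA.gqcInf_genPureStates_le hJ).antisymm
    (hA.gsvmInf_le_gqcInf.trans (gqcInf_anti extremePoints_subset))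

end IsCoerciveSandwich

section Minimizers

variable [MeasurableSpace.CountablyGenerated X] [MeasurableSingletonClass X]
  (hA : IsCoerciveSandwich J a A) (hJ : DenseRange J) {E : ℝ} (hE : (E : EReal) = gsvmInf J a)

namespace IsCoerciveSandwich

include hA hJ hE

theorem shifted_gsvmInf_nonneg (z : X) : 0 ≤ shifted J A E z :=
  hA.shifted_nonneg hJ (hE.trans (hA.gqcInf_genPureStates_eq hJ).symm).le z

theorem shiftedResolvent_gsvmInf_le_one (z : X) : shiftedResolvent J A E z ≤ 1 :=
  have hG := hA.shifted_gsvmInf_nonneg hJ hE z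
  formResolvent_le_one (isSelfAdjoint_invSqrtT J) hG (hA.isUnit hG)

theorem isGqcMinimizer_iff {𝒮 : Set (StrongDual ℂ (BOp H))} (h𝒮 : 𝒮 ⊆ genStates H)
    (hinf : gqcInf J a 𝒮 = gsvmInf J a) {ρ : StrongDual ℂ (BOp H)} {z : X} :
    IsGqcMinimizer J a 𝒮 ρ z ↔ ρ ∈ 𝒮 ∧ ρ (shiftedResolvent J A E z) = 1 := by
  have hG := hA.shifted_gsvmInf_nonneg hJ hE z
  refine and_congr_right fun hρ => ⟨?_, fun hK =>
    ⟨E, hA.isGqcEnergy_of_apply_shiftedResolvent hG (h𝒮 hρ) hK, hE.trans hinf.symm⟩⟩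
  rintro ⟨e, he, heinf⟩
  obtain rfl : e = E := EReal.coe_eq_coe_iff.mp (heinf.trans (hinf.trans hE.symm))
  exact hA.apply_shiftedResolvent_eq_one hG (h𝒮 hρ) he

theorem isGqcMinimizer_genStates_iff {ρ : StrongDual ℂ (BOp H)} {z : X} :
    IsGqcMinimizer J a (genStates H) ρ z ↔ ρ ∈ stateFace (shiftedResolvent J A E z) :=
  hA.isGqcMinimizer_iff hJ hE subset_rfl (hA.gqcInf_genStates_eq hJ)

theorem isGqcMinimizer_genPureStates_iff {σ : StrongDual ℂ (BOp H)} {z : X} :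
    IsGqcMinimizer J a (genPureStates H) σ z ↔
      σ ∈ genPureStates H ∧ σ (shiftedResolvent J A E z) = 1 :=
  hA.isGqcMinimizer_iff hJ hE extremePoints_subset (hA.gqcInf_genPureStates_eq hJ)

omit hE

theorem isConcentrated (hn : IsGsvmMinimizer J a n) : IsConcentrated J a n := by
  obtain ⟨hnorm, E, henergy, hE⟩ := hn
  have hG := hA.shifted_gsvmInf_nonneg hJ hE
  refine ⟨⟨_, n.isWeakDensity_cellLimit⟩, fun ρ hρ => ?_⟩
  filter_upwards [hA.ae_apply_shiftedResolvent_eq_one hnorm hG henergy hρ, hρ.1] with z hz hstate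
  refine ⟨(hA.isGqcMinimizer_genStates_iff hJ hE).mpr ⟨hstate, hz⟩, ?_⟩
  simp only [hA.isGqcMinimizer_genPureStates_iff hJ hE]
  exact toWeakDual_mem_closure_convexHull_pure (hA.shiftedResolvent_gsvmInf_le_one hJ hE z)
    ⟨hstate, hz⟩

theorem isGsvmMinimizer_dirac {ρ : StrongDual ℂ (BOp H)} {z : X}
    (hmin : IsGqcMinimizer J a (genStates H) ρ z) :
    IsGsvmMinimizer J a (GenMeasure.dirac z hmin.1.1) := by
  obtain ⟨hρ, e, he, heinf⟩ := hmin
  refine ⟨?_, e, hA.isGsvmEnergy_dirac hρ.1 he, heinf.trans (hA.gqcInf_genStates_eq hJ)⟩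
  rw [GenMeasure.dirac_univ, hρ.2]

theorem exists_isGqcMinimizer (hn : IsGsvmMinimizer J a n) :
    ∃ ρ z, IsGqcMinimizer J a (genStates H) ρ z := by
  obtain ⟨⟨ρ, hρ⟩, hmin⟩ := hA.isConcentrated hJ hn
  have hmass : n.normMeasure Set.univ = 1 := by
    rw [n.normMeasure_apply MeasurableSet.univ, hn.1, ENNReal.ofReal_one]
  have : NeZero n.normMeasure := ⟨fun h => by simp [h] at hmass⟩
  obtain ⟨z, hz, -⟩ := (hmin ρ hρ).exists
  exact ⟨ρ z, z, hz⟩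

theorem exists_pure_isGqcMinimizer {ρ : StrongDual ℂ (BOp H)} {z : X}
    (hmin : IsGqcMinimizer J a (genStates H) ρ z) :
    ∃ σ, IsGqcMinimizer J a (genPureStates H) σ z := by
  obtain ⟨e, -, heinf⟩ := hmin.2
  have hE := heinf.trans (hA.gqcInf_genStates_eq hJ)
  simp only [hA.isGqcMinimizer_genPureStates_iff hJ hE]
  exact exists_pure_of_mem_stateFace (hA.shiftedResolvent_gsvmInf_le_one hJ hE z)
    ((hA.isGqcMinimizer_genStates_iff hJ hE).mp hmin)

theorem isGqcMinimizer_genStates_of_pure {σ : StrongDual ℂ (BOp H)} {z : X}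
    (hmin : IsGqcMinimizer J a (genPureStates H) σ z) : IsGqcMinimizer J a (genStates H) σ z := by
  obtain ⟨hσ, e, he, heinf⟩ := hmin
  exact ⟨extremePoints_subset hσ, e, he,
    heinf.trans ((hA.gqcInf_genPureStates_eq hJ).trans (hA.gqcInf_genStates_eq hJ).symm)⟩

theorem minimizerEquivalence : MinimizerEquivalence J a := by
  refine ⟨⟨fun ⟨_, _, hmin⟩ => ⟨_, hA.isGsvmMinimizer_dirac hJ hmin⟩,
    fun ⟨_, hn⟩ => hA.exists_isGqcMinimizer hJ hn⟩, ⟨fun ⟨_, _, hmin⟩ => ⟨_,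
    hA.isGsvmMinimizer_dirac hJ (hA.isGqcMinimizer_genStates_of_pure hJ hmin)⟩, ?_⟩,
    fun _ hn => hA.isConcentrated hJ hn⟩
  rintro ⟨n, hn⟩
  obtain ⟨ρ, z, hmin⟩ := hA.exists_isGqcMinimizer hJ hn
  obtain ⟨σ, hσ⟩ := hA.exists_pure_isGqcMinimizer hJ hmin
  exact ⟨σ, z, hσ⟩

end IsCoerciveSandwich

end Minimizers

theorem minimizerEquivalence_of_coercive [MeasurableSpace.CountablyGenerated X]
    [MeasurableSingletonClass X] (hinj : Function.Injective J) (hJ : DenseRange J)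
    {S : X → Q →L[ℂ] Q} (hS : ∀ z, IsSelfAdjoint (S z))
    (hcoer : ∀ z, ∃ δ > (0 : ℝ), ∃ C : ℝ, ∀ u,
      δ * ‖u‖ ^ 2 ≤ (inner ℂ u (S z u)).re + C * ‖J u‖ ^ 2) :
    MinimizerEquivalence J fun z u v => inner ℂ u (S z v) := by
  refine IsCoerciveSandwich.minimizerEquivalence (A := fun z => sandwich J (S z))
    ⟨fun z _ => isSandwich_iff hinj hJ, fun z => isSelfAdjoint_sandwich (hS z), fun z => ?_⟩ hJ
  obtain ⟨δ, hδ, C, hle⟩ := hcoer z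
  exact ⟨δ, hδ, C, smul_one_le_sandwich_add hJ (hS z) hle⟩

end Equivalence

theorem memLp_ofReal_of_hasCompactSupport {X : Type*} [TopologicalSpace X] [MeasurableSpace X]
    [OpensMeasurableSpace X] [R1Space X] {μ : Measure X} [IsFiniteMeasureOnCompacts μ]
    {p : ℝ≥0∞} {φ : X → ℝ} (hφ : Continuous φ) (hc : HasCompactSupport φ) :
    MemLp (fun x => (φ x : ℂ)) p μ :=
  (hφ.memLp_of_hasCompactSupport hc).ofReal

theorem memLp_sqrt_mul_of_hasCompactSupport {X : Type*} [TopologicalSpace X] [T2Space X]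
    [SecondCountableTopology X] [MeasurableSpace X] [OpensMeasurableSpace X] {μ : Measure X}
    [IsFiniteMeasureOnCompacts μ] {W : X → ℝ} (hW : ∀ x, 0 ≤ W x) (hWl : LocallyIntegrable W μ)
    {φ : X → ℝ} (hφ : Continuous φ) (hc : HasCompactSupport φ) :
    MemLp (fun x => (√(W x) : ℂ) * (φ x : ℂ)) 2 μ := by
  have hm : AEStronglyMeasurable (fun x => √(W x) * φ x) μ :=
    (Real.continuous_sqrt.comp_aestronglyMeasurable hWl.aestronglyMeasurable).mul
      (hφ.memLp_of_hasCompactSupport (p := 2) hc).aestronglyMeasurable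
  have hsq : Integrable (fun x => (φ x ^ 2) • W x) μ :=
    hWl.integrable_smul_left_of_hasCompactSupport (hφ.pow 2)
      (hc.comp_left (g := fun t : ℝ => t ^ 2) (by simp))
  have hmem : MemLp (fun x => √(W x) * φ x) 2 μ := by
    refine (memLp_two_iff_integrable_sq hm).mpr (hsq.congr (Eventually.of_forall fun x => ?_))
    simp only [mul_pow, Real.sq_sqrt (hW x), smul_eq_mul, mul_comm]
  exact (hmem.ofReal (K := ℂ)).ae_eq (Eventually.of_forall fun x => Complex.ofReal_mul _ _)

section FormDomain

variable {N d : ℕ} {κ : Fin N → ℝ} {W : Cfg N d → ℝ}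

theorem eq_zero_of_forall_integral_eq_zero {f : L2 N d}
    (h : ∀ φ : Cfg N d → ℝ, ContDiff ℝ ((⊤ : ℕ∞) : WithTop ℕ∞) φ → HasCompactSupport φ →
      ∫ x, (φ x : ℂ) * f x = 0) : f = 0 :=
  (Lp.eq_zero_iff_ae_eq_zero).mpr (ae_eq_zero_of_integral_contDiff_smul_eq_zero
    ((Lp.memLp f).locallyIntegrable one_le_two)
    fun φ hφ hc => by simpa only [Complex.real_smul] using h φ hφ hc)

theorem IsWeakDeriv.const_smul {p : Fin N × Fin d} {f g : L2 N d} (h : IsWeakDeriv p f g) (c : ℂ) :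
    IsWeakDeriv p (c • f) (c • g) := by
  obtain ⟨𝓛, h𝓛⟩ := isWeakDeriv_iff (N := N) (d := d) p
  rw [h𝓛] at h ⊢
  intro ℓ hℓ
  rw [map_smul, map_smul, h ℓ hℓ, smul_neg]

theorem IsWeakDeriv.eq_zero {p : Fin N × Fin d} {g : L2 N d} (h : IsWeakDeriv p 0 g) : g = 0 := by
  refine eq_zero_of_forall_integral_eq_zero fun φ hφ hc => neg_eq_zero.mp ?_
  rw [← h φ hφ hc]
  refine integral_eq_zero_of_ae ?_
  filter_upwards [Lp.coeFn_zero ℂ 2 (volume : Measure (Cfg N d))] with x hx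
  rw [hx, Pi.zero_apply, mul_zero]

theorem IsSqrtMul.eq_zero {g : L2 N d} (h : IsSqrtMul W 0 g) : g = 0 := by
  refine (Lp.eq_zero_iff_ae_eq_zero).mpr ?_
  filter_upwards [h, Lp.coeFn_zero ℂ 2 (volume : Measure (Cfg N d))] with x hg hzero
  rw [hg, hzero, Pi.zero_apply, mul_zero]

theorem incl_injective : Function.Injective (incl κ W) := by
  rw [injective_iff_map_eq_zero]
  intro u hu
  have hstate : u.1 .state = 0 := hu
  obtain ⟨hpot, hgrad⟩ := u.2
  refine Subtype.ext (PiLp.ext fun i => ?_)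
  cases i with
  | state => exact hstate
  | pot => exact (hstate ▸ hpot).eq_zero
  | grad p => exact IsWeakDeriv.eq_zero (by simpa only [hstate, smul_zero] using hgrad p)

theorem continuous_fderiv_apply {φ : Cfg N d → ℝ}
    (hφ : ContDiff ℝ ((⊤ : ℕ∞) : WithTop ℕ∞) φ) (v : Cfg N d) :
    Continuous fun x => fderiv ℝ φ x v :=
  (hφ.continuous_fderiv (by simp)).clm_apply continuous_const

theorem memLp_fderiv_apply {φ : Cfg N d → ℝ} (hφ : ContDiff ℝ ((⊤ : ℕ∞) : WithTop ℕ∞) φ)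
    (hc : HasCompactSupport φ) (v : Cfg N d) :
    MemLp (fun x => ((fderiv ℝ φ x v : ℝ) : ℂ)) 2 (volume : Measure (Cfg N d)) :=
  memLp_ofReal_of_hasCompactSupport (continuous_fderiv_apply hφ v) (hc.fderiv_apply ℝ v)

theorem integral_mul_fderiv_eq_neg {φ ψ : Cfg N d → ℝ}
    (hφ : ContDiff ℝ ((⊤ : ℕ∞) : WithTop ℕ∞) φ) (hc : HasCompactSupport φ)
    (hψ : ContDiff ℝ ((⊤ : ℕ∞) : WithTop ℕ∞) ψ) (v : Cfg N d) :
    ∫ x, φ x * fderiv ℝ ψ x v = -∫ x, fderiv ℝ φ x v * ψ x :=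
  integral_mul_fderiv_eq_neg_fderiv_mul_of_integrable
    (((continuous_fderiv_apply hφ v).mul hψ.continuous).integrable_of_hasCompactSupport
      (hc.fderiv_apply ℝ v).mul_right)
    ((hφ.continuous.mul (continuous_fderiv_apply hψ v)).integrable_of_hasCompactSupport
      hc.mul_right)
    ((hφ.continuous.mul hψ.continuous).integrable_of_hasCompactSupport hc.mul_right)
    (fun _ _ => (hφ.differentiable (by simp)).differentiableAt)
    (fun _ _ => (hψ.differentiable (by simp)).differentiableAt)

theorem isWeakDeriv_fderiv {φ : Cfg N d → ℝ} (hφ : ContDiff ℝ ((⊤ : ℕ∞) : WithTop ℕ∞) φ)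
    (hc : HasCompactSupport φ) (p : Fin N × Fin d) :
    IsWeakDeriv p ((memLp_ofReal_of_hasCompactSupport hφ.continuous hc).toLp _)
      ((memLp_fderiv_apply hφ hc (EuclideanSpace.single p 1)).toLp _) := by
  intro ψ hψ _
  have hparts := congrArg (fun t : ℝ => (t : ℂ))
    (integral_mul_fderiv_eq_neg hφ hc hψ (EuclideanSpace.single p 1))
  rw [Complex.ofReal_neg, ← integral_complex_ofReal, ← integral_complex_ofReal] at hparts
  refine Eq.trans (integral_congr_ae ?_) (hparts.trans (congrArg _ (integral_congr_ae ?_)))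
  · filter_upwards [(memLp_ofReal_of_hasCompactSupport (p := 2) (μ := volume)
      hφ.continuous hc).coeFn_toLp] with x hx
    rw [hx, Complex.ofReal_mul, mul_comm]
  · filter_upwards [(memLp_fderiv_apply hφ hc (EuclideanSpace.single p 1)).coeFn_toLp] with x hx
    rw [hx, Complex.ofReal_mul, mul_comm]

theorem exists_incl_ae_eq (hW : ∀ x, 0 ≤ W x) (hWl : LocallyIntegrable W volume)
    {φ : Cfg N d → ℝ} (hφ : ContDiff ℝ ((⊤ : ℕ∞) : WithTop ℕ∞) φ) (hc : HasCompactSupport φ) :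
    ∃ u : FormDomain κ W, incl κ W u =ᵐ[volume] fun x => (φ x : ℂ) := by
  have hstate : MemLp (fun x => (φ x : ℂ)) 2 (volume : Measure (Cfg N d)) :=
    memLp_ofReal_of_hasCompactSupport hφ.continuous hc
  have hpot := memLp_sqrt_mul_of_hasCompactSupport hW hWl hφ.continuous hc
  refine ⟨⟨WithLp.toLp 2 fun i => match i with
    | .state => hstate.toLp _
    | .pot => hpot.toLp _
    | .grad p => ((√(κ p.1) : ℝ) : ℂ) •
        (memLp_fderiv_apply hφ hc (EuclideanSpace.single p 1)).toLp _,
    ?_, fun p => (isWeakDeriv_fderiv hφ hc p).const_smul _⟩, hstate.coeFn_toLp⟩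
  filter_upwards [hstate.coeFn_toLp, hpot.coeFn_toLp] with x hx hpx
  exact hpx.trans (congrArg _ hx.symm)

theorem denseRange_incl (hW : ∀ x, 0 ≤ W x) (hWl : LocallyIntegrable W volume) :
    DenseRange (incl κ W) := by
  have horth : (LinearMap.range (incl κ W).toLinearMap)ᗮ = ⊥ := by
    refine (Submodule.eq_bot_iff _).mpr fun f hf =>
      eq_zero_of_forall_integral_eq_zero fun φ hφ hc => ?_
    obtain ⟨u, hu⟩ := exists_incl_ae_eq (κ := κ) hW hWl hφ hc
    rw [← (Submodule.mem_orthogonal _ _).mp hf _ ⟨u, rfl⟩, L2.inner_def]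
    refine integral_congr_ae ?_
    filter_upwards [hu] with x hx
    rw [RCLike.inner_apply, ContinuousLinearMap.coe_coe, hx, Complex.conj_ofReal, mul_comm]
  exact Submodule.dense_iff_topologicalClosure_eq_top.mpr
    (Submodule.topologicalClosure_eq_top_iff.mpr horth)

theorem sum_comp {M : Type*} [AddCommMonoid M] (f : Comp N d → M) :
    ∑ i, f i = f .state + (f .pot + ∑ p, f (.grad p)) := by
  let e : Option (Option (Fin N × Fin d)) ≃ Comp N d :=
    { toFun
        | none => .state
        | some none => .pot
        | some (some p) => .grad p
      invFun
        | .state => none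
        | .pot => some none
        | .grad p => some (some p)
      left_inv := by rintro (_ | _ | _) <;> rfl
      right_inv := by rintro (_ | _ | _) <;> rfl }
  rw [← Equiv.sum_comp e, Fintype.sum_option, Fintype.sum_option]
  rfl

theorem inner_formDomain (u v : FormDomain κ W) :
    inner ℂ u v = inner ℂ (u.1 .state) (v.1 .state) + freeForm u v := by
  rw [Submodule.coe_inner, PiLp.inner_apply, sum_comp, freeForm]

theorem sum_norm_grad_sq_le (u : FormDomain κ W) : ∑ p, ‖u.1 (.grad p)‖ ^ 2 ≤ ‖u‖ ^ 2 := by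
  rw [Submodule.coe_norm, PiLp.norm_sq_eq_of_L2, sum_comp]
  exact (le_add_of_nonneg_left (sq_nonneg _)).trans (le_add_of_nonneg_left (sq_nonneg _))

end FormDomain

section FirstOrder

variable {N d : ℕ} {κ : Fin N → ℝ} {W : Cfg N d → ℝ}

/-- The components `ψ`, `√𝒲 ψ` and `√κⱼ ∂_{j,i} ψ` as bounded operators on the form domain. -/
def component (κ : Fin N → ℝ) (W : Cfg N d → ℝ) (i : Comp N d) : FormDomain κ W →L[ℂ] L2 N d :=
  (PiLp.proj 2 (fun _ : Comp N d => L2 N d) i) ∘L (formSubmodule κ W).subtypeL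

/-- The operator on the form domain, with its `T`-inner product, that represents the form of the
first-order perturbation `T + ∑ₚ (∂ₚ* Bₚ + Bₚ* ∂ₚ) + D`, where `∂ₚ` stands for `√κⱼ ∂_{j,i}`. -/
def firstOrderOp (κ : Fin N → ℝ) (W : Cfg N d → ℝ) (B : Fin N × Fin d → BOp (L2 N d))
    (D : BOp (L2 N d)) : BOp (FormDomain κ W) :=
  1 + ∑ p, (ContinuousLinearMap.adjoint (component κ W (.grad p)) ∘L B p ∘L component κ W .state
      + ContinuousLinearMap.adjoint (component κ W .state) ∘L
        ContinuousLinearMap.adjoint (B p) ∘L component κ W (.grad p))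
    + ContinuousLinearMap.adjoint (component κ W .state) ∘L D ∘L component κ W .state

theorem inner_firstOrderOp (B : Fin N × Fin d → BOp (L2 N d)) (D : BOp (L2 N d))
    (u v : FormDomain κ W) :
    inner ℂ u (firstOrderOp κ W B D v) = inner ℂ u v
      + ∑ p, (inner ℂ (u.1 (.grad p)) (B p (v.1 .state))
          + inner ℂ (B p (u.1 .state)) (v.1 (.grad p)))
      + inner ℂ (u.1 .state) (D (v.1 .state)) := by
  simp only [firstOrderOp, add_apply, sum_apply, one_apply_eq_self, inner_add_right, inner_sum,
    ContinuousLinearMap.comp_apply, ContinuousLinearMap.adjoint_inner_right]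
  rfl

theorem isSelfAdjoint_firstOrderOp (B : Fin N × Fin d → BOp (L2 N d)) {D : BOp (L2 N d)}
    (hD : IsSelfAdjoint D) : IsSelfAdjoint (firstOrderOp κ W B D) := by
  refine ((IsSelfAdjoint.one _).add (isSelfAdjoint_sum _ fun p _ => ?_)).add (hD.adjoint_conj _)
  rw [ContinuousLinearMap.isSelfAdjoint_iff', map_add, ContinuousLinearMap.adjoint_comp,
    ContinuousLinearMap.adjoint_comp, ContinuousLinearMap.adjoint_comp,
    ContinuousLinearMap.adjoint_comp, ContinuousLinearMap.adjoint_adjoint,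
    ContinuousLinearMap.adjoint_adjoint, ContinuousLinearMap.adjoint_adjoint, add_comm]
  rfl

theorem neg_le_two_mul_re_inner {E : Type*} [NormedAddCommGroup E] [InnerProductSpace ℂ E]
    (x y : E) : -(1 / 2 * ‖x‖ ^ 2 + 2 * ‖y‖ ^ 2) ≤ 2 * (inner ℂ x y).re := by
  have hCS := neg_le_of_abs_le
    ((Complex.abs_re_le_norm _).trans (norm_inner_le_norm (𝕜 := ℂ) x y))
  nlinarith only [hCS, sq_nonneg (‖x‖ - 2 * ‖y‖)]

theorem neg_opNorm_mul_norm_sq_le_re_inner {E : Type*} [NormedAddCommGroup E]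
    [InnerProductSpace ℂ E] (D : BOp E) (x : E) : -(‖D‖ * ‖x‖ ^ 2) ≤ (inner ℂ x (D x)).re := by
  refine neg_le_of_abs_le ((Complex.abs_re_le_norm _).trans ((norm_inner_le_norm _ _).trans ?_))
  calc ‖x‖ * ‖D x‖ ≤ ‖x‖ * (‖D‖ * ‖x‖) := by gcongr; exact D.le_opNorm x
    _ = ‖D‖ * ‖x‖ ^ 2 := by ring

theorem re_inner_add_re_inner_swap {E : Type*} [NormedAddCommGroup E] [InnerProductSpace ℂ E]
    (x y : E) : (inner ℂ x y).re + (inner ℂ y x).re = 2 * (inner ℂ x y).re := by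
  rw [← inner_conj_symm y x, Complex.conj_re, two_mul]

theorem half_norm_sq_le_re_inner_firstOrderOp (B : Fin N × Fin d → BOp (L2 N d))
    (D : BOp (L2 N d)) (u : FormDomain κ W) :
    1 / 2 * ‖u‖ ^ 2 ≤ (inner ℂ u (firstOrderOp κ W B D u)).re
      + (∑ p, 2 * ‖B p‖ ^ 2 + ‖D‖) * ‖incl κ W u‖ ^ 2 := by
  have hincl : incl κ W u = u.1 .state := rfl
  have hcross : -∑ p, (1 / 2 * ‖u.1 (.grad p)‖ ^ 2 + 2 * ‖B p‖ ^ 2 * ‖u.1 .state‖ ^ 2) ≤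
      ∑ p, 2 * (inner ℂ (u.1 (.grad p)) (B p (u.1 .state))).re := by
    rw [← Finset.sum_neg_distrib]
    refine Finset.sum_le_sum fun p _ => le_trans (neg_le_neg ?_) (neg_le_two_mul_re_inner _ _)
    rw [mul_assoc, ← mul_pow]
    gcongr
    exact (B p).le_opNorm _
  rw [Finset.sum_add_distrib, ← Finset.mul_sum, ← Finset.sum_mul] at hcross
  have huu : (inner ℂ u u : ℂ).re = ‖u‖ ^ 2 := (norm_sq_eq_re_inner (𝕜 := ℂ) u).symm
  rw [inner_firstOrderOp, Complex.add_re, Complex.add_re, Complex.re_sum, huu, hincl]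
  simp only [Complex.add_re, re_inner_add_re_inner_swap]
  linarith only [hcross, neg_opNorm_mul_norm_sq_le_re_inner D (u.1 .state), sum_norm_grad_sq_le u]

theorem minimizerEquivalence_firstOrder {X : Type*} [MeasurableSpace X]
    [MeasurableSpace.CountablyGenerated X] [MeasurableSingletonClass X]
    (hW : ∀ x, 0 ≤ W x) (hWl : LocallyIntegrable W volume)
    (B : X → Fin N × Fin d → BOp (L2 N d)) {D : X → BOp (L2 N d)}
    (hD : ∀ z, IsSelfAdjoint (D z)) :
    MinimizerEquivalence (incl κ W) fun z u v => inner ℂ u (firstOrderOp κ W (B z) (D z) v) :=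
  minimizerEquivalence_of_coercive incl_injective (denseRange_incl hW hWl)
    (fun z => isSelfAdjoint_firstOrderOp (B z) (hD z))
    fun z => ⟨1 / 2, one_half_pos, _, half_norm_sq_le_re_inner_firstOrderOp (B z) (D z)⟩

end FirstOrder

section Multiplication

variable {X : Type*} [MeasurableSpace X] {μ : Measure X} {b : X → ℝ}

/-- Multiplication by the bounded real function `b` on `L²`. -/
def mulOp (hb : MemLp b ⊤ μ) : BOp (Lp ℂ 2 μ) :=
  (ContinuousLinearMap.mul ℂ ℂ).holderL μ ⊤ 2 2 ((hb.ofReal (K := ℂ)).toLp _)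

theorem mulOp_ae_eq (hb : MemLp b ⊤ μ) (f : Lp ℂ 2 μ) :
    mulOp hb f =ᵐ[μ] fun x => (b x : ℂ) * f x := by
  filter_upwards [(ContinuousLinearMap.mul ℂ ℂ).coeFn_holder (r := 2)
    ((hb.ofReal (K := ℂ)).toLp _) f, (hb.ofReal (K := ℂ)).coeFn_toLp] with x hholder hcoe
  refine hholder.trans ?_
  rw [hcoe]
  rfl

theorem inner_mulOp (hb : MemLp b ⊤ μ) (f g : Lp ℂ 2 μ) :
    inner ℂ f (mulOp hb g) = ∫ x, starRingEnd ℂ (f x) * b x * g x ∂μ := by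
  rw [L2.inner_def]
  refine integral_congr_ae ?_
  filter_upwards [mulOp_ae_eq hb g] with x hx
  rw [RCLike.inner_apply, hx]
  ring

theorem isSelfAdjoint_mulOp (hb : MemLp b ⊤ μ) : IsSelfAdjoint (mulOp hb) := by
  refine ContinuousLinearMap.isSelfAdjoint_iff_isSymmetric.mpr fun f g => ?_
  rw [ContinuousLinearMap.coe_coe, inner_mulOp, L2.inner_def]
  refine integral_congr_ae ?_
  filter_upwards [mulOp_ae_eq hb f] with x hx
  rw [RCLike.inner_apply, hx, map_mul, Complex.conj_ofReal]
  ring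

theorem inner_mulOp_left (hb : MemLp b ⊤ μ) (f g : Lp ℂ 2 μ) :
    inner ℂ (mulOp hb f) g = inner ℂ f (mulOp hb g) :=
  ContinuousLinearMap.isSelfAdjoint_iff_isSymmetric.mp (isSelfAdjoint_mulOp hb) f g

theorem memLp_top_comp_of_quasiMeasurePreserving {Y : Type*} [MeasurableSpace Y] {ν : Measure Y}
    {b : Y → ℝ} (hb : MemLp b ⊤ ν) {f : X → Y} (hf : Measure.QuasiMeasurePreserving f μ ν) :
    MemLp (fun x => b (f x)) ⊤ μ := by
  refine MemLp.comp_of_map ⟨hb.aestronglyMeasurable.mono_ac hf.absolutelyContinuous, ?_⟩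
    hf.aemeasurable
  rw [eLpNorm_exponent_top]
  exact (eLpNormEssSup_mono_measure b hf.absolutelyContinuous).trans_lt
    (eLpNorm_exponent_top (f := b) (μ := ν) ▸ hb.eLpNorm_lt_top)

end Multiplication

section Position

variable {N d : ℕ}

/-- The linear map `x ↦ xⱼ`. -/
def posLinear (j : Fin N) : Cfg N d →ₗ[ℝ] EuclideanSpace ℝ (Fin d) where
  toFun x := pos x j
  map_add' _ _ := rfl
  map_smul' _ _ := rfl

theorem posLinear_surjective (j : Fin N) :
    Function.Surjective (posLinear j : Cfg N d →ₗ[ℝ] EuclideanSpace ℝ (Fin d)) :=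
  fun y => ⟨WithLp.toLp 2 fun p => y p.2, rfl⟩

theorem quasiMeasurePreserving_pos (j : Fin N) :
    Measure.QuasiMeasurePreserving (fun x : Cfg N d => pos x j) volume volume := by
  refine ⟨(LinearMap.continuous_of_finiteDimensional (posLinear j)).measurable, ?_⟩
  obtain ⟨c, -, hc⟩ := LinearMap.exists_map_addHaar_eq_smul_addHaar (posLinear (d := d) j)
    volume volume (posLinear_surjective j)
  change Measure.map (posLinear j) volume ≪ volume
  exact hc ▸ Measure.smul_absolutelyContinuous

theorem memLp_comp_pos {b : EuclideanSpace ℝ (Fin d) → ℝ} (hb : MemLp b ⊤ volume) (j : Fin N) :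
    MemLp (fun x : Cfg N d => b (pos x j)) ⊤ volume :=
  memLp_top_comp_of_quasiMeasurePreserving hb (quasiMeasurePreserving_pos j)

theorem mulForm_eq_inner_mulOp {b : Cfg N d → ℝ} (hb : MemLp b ⊤ volume) (f g : L2 N d) :
    mulForm (fun x => (b x : ℂ)) f g = inner ℂ f (mulOp hb g) :=
  (inner_mulOp hb f g).symm

end Position

namespace Dispersion

variable {𝔥 : Type*} [NormedAddCommGroup 𝔥] [InnerProductSpace ℂ 𝔥] [CompleteSpace 𝔥]
  {ω : Dispersion 𝔥}

/-- The graph map `y ↦ (y, ω y)`. -/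
def graphMap (ω : Dispersion 𝔥) (y : ω.SmoothVec) : 𝔥 × 𝔥 := (ω.toDomain y, ω.op (ω.toDomain y))

theorem norm_sq_le_mul_norm_op (y : ω.SmoothVec) :
    ‖y‖ ^ 2 ≤ ‖(ω.toDomain y : 𝔥)‖ * ‖ω.op (ω.toDomain y)‖ :=
  calc ‖y‖ ^ 2 = (inner ℂ (ω.toDomain y : 𝔥) (ω.op (ω.toDomain y))).re :=
        norm_sq_eq_re_inner (𝕜 := ℂ) y
    _ ≤ ‖inner ℂ (ω.toDomain y : 𝔥) (ω.op (ω.toDomain y))‖ := Complex.re_le_norm _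
    _ ≤ ‖(ω.toDomain y : 𝔥)‖ * ‖ω.op (ω.toDomain y)‖ := norm_inner_le_norm _ _

theorem graphMap_sub (x y : ω.SmoothVec) :
    ω.graphMap (x - y) = ω.graphMap x - ω.graphMap y := by
  rw [graphMap, map_sub, LinearPMap.map_sub]
  rfl

theorem graphMap_injective : Function.Injective ω.graphMap :=
  fun _ _ h => Subtype.ext (congrArg Prod.fst h)

theorem antilipschitzWith_graphMap : AntilipschitzWith 1 ω.graphMap := by
  refine AntilipschitzWith.of_le_mul_dist fun x y => ?_
  rw [NNReal.coe_one, one_mul, dist_eq_norm, dist_eq_norm, ← graphMap_sub]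
  refine le_of_sq_le_sq ?_ (norm_nonneg _)
  calc ‖x - y‖ ^ 2 ≤ ‖(ω.graphMap (x - y)).1‖ * ‖(ω.graphMap (x - y)).2‖ :=
        norm_sq_le_mul_norm_op (x - y)
    _ ≤ ‖ω.graphMap (x - y)‖ * ‖ω.graphMap (x - y)‖ :=
        mul_le_mul (norm_fst_le _) (norm_snd_le _) (norm_nonneg _) (norm_nonneg _)
    _ = ‖ω.graphMap (x - y)‖ ^ 2 := (sq _).symm

theorem separableSpace_smoothVec [TopologicalSpace.SeparableSpace 𝔥] :
    TopologicalSpace.SeparableSpace ω.SmoothVec := by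
  have : SecondCountableTopology 𝔥 := UniformSpace.secondCountable_of_separable 𝔥
  let toRange := Equiv.ofInjective ω.graphMap graphMap_injective
  have hlip : LipschitzWith 1 toRange.symm :=
    AntilipschitzWith.to_rightInverse (f := toRange) antilipschitzWith_graphMap
      toRange.apply_symm_apply
  exact toRange.symm.surjective.denseRange.separableSpace hlip.continuous

instance [TopologicalSpace.SeparableSpace 𝔥] : SecondCountableTopology ω.FieldSpace := by
  have : TopologicalSpace.SeparableSpace ω.SmoothVec := separableSpace_smoothVec
  exact UniformSpace.secondCountable_of_separable _

theorem uniformContinuous_inner_toDomain {v : 𝔥} {C : ℝ} (hv : ω.InvSqrtBound v C) :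
    UniformContinuous fun y : ω.SmoothVec => inner ℂ v (ω.toDomain y : 𝔥) := by
  refine (LipschitzWith.of_dist_le' (K := C) fun x y => ?_).uniformContinuous
  rw [dist_eq_norm, dist_eq_norm, ← inner_sub_right, ← AddSubgroupClass.coe_sub, ← map_sub]
  exact hv (x - y)

theorem continuous_pairing (v : 𝔥) : Continuous (ω.pairing v) :=
  UniformSpace.Completion.continuous_extension

theorem pairing_coe {v : 𝔥} {C : ℝ} (hv : ω.InvSqrtBound v C) (y : ω.SmoothVec) :
    ω.pairing v (y : ω.FieldSpace) = inner ℂ v (ω.toDomain y : 𝔥) :=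
  UniformSpace.Completion.extension_coe (uniformContinuous_inner_toDomain hv) y

theorem norm_pairing_le {v : 𝔥} {C : ℝ} (hv : ω.InvSqrtBound v C) (z : ω.FieldSpace) :
    ‖ω.pairing v z‖ ≤ C * ‖z‖ := by
  induction z using UniformSpace.Completion.induction_on with
  | hp => exact isClosed_le (continuous_pairing v).norm (continuous_const.mul continuous_norm)
  | ih y =>
    rw [pairing_coe hv, UniformSpace.Completion.norm_coe]
    exact hv y

variable {d : ℕ} {lam : EuclideanSpace ℝ (Fin d) → 𝔥}

theorem aestronglyMeasurable_pairing (hlam : ω.IsFormFactor lam) (z : ω.FieldSpace) :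
    AEStronglyMeasurable (fun x => ω.pairing (lam x) z) volume := by
  obtain ⟨hmem, C, hC⟩ := hlam
  obtain ⟨x, hx, hlim⟩ := mem_closure_iff_seq_limit.mp
    (UniformSpace.Completion.denseRange_coe (α := ω.SmoothVec) z)
  choose y hy using hx
  refine aestronglyMeasurable_of_tendsto_ae atTop
    (f := fun n k => inner ℂ (lam k) (ω.toDomain (y n) : 𝔥))
    (fun n => hmem.aestronglyMeasurable.inner aestronglyMeasurable_const) ?_
  filter_upwards [hC] with k hk
  refine (((continuous_pairing (lam k)).tendsto z).comp hlim).congr fun n => ?_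
  rw [Function.comp_apply, ← hy, pairing_coe hk]

theorem memLp_pairing (hlam : ω.IsFormFactor lam) (z : ω.FieldSpace) :
    MemLp (fun x => ω.pairing (lam x) z) ⊤ volume :=
  have ⟨C, hC⟩ := hlam.2
  memLp_top_of_bound (aestronglyMeasurable_pairing hlam z) (C * ‖z‖)
    (hC.mono fun _ hx => norm_pairing_le hx z)

theorem memLp_classicalField (hlam : ω.IsFormFactor lam) (z : ω.FieldSpace) :
    MemLp (ω.classicalField lam z) ⊤ volume :=
  (memLp_pairing hlam z).re.const_mul 2

end Dispersion

section Polaron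

variable {d : ℕ}

theorem measurable_polaronLow (r : ℝ) :
    Measurable (polaronLow r : EuclideanSpace ℝ (Fin d) → ℝ) :=
  Measurable.ite (measurableSet_le measurable_norm measurable_const)
    (measurable_norm.pow_const _) measurable_const

theorem measurable_polaronHigh (r : ℝ) (i : Fin d) : Measurable (polaronHigh r i) :=
  Measurable.ite (measurableSet_lt measurable_const measurable_norm)
    ((measurable_norm.pow_const _).mul (Measurable.div (by fun_prop) measurable_norm))
    measurable_const

theorem stronglyMeasurable_polaronPairing {χ : EuclideanSpace ℝ (Fin d) → ℝ} (hχ : Measurable χ)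
    (z : PolaronSpace d) : StronglyMeasurable (polaronPairing χ z) := by
  have hz : Measurable z := (Lp.stronglyMeasurable z).measurable
  have hintegrand : Measurable fun p : EuclideanSpace ℝ (Fin d) × EuclideanSpace ℝ (Fin d) =>
      starRingEnd ℂ (z p.2) * Complex.exp (-(Complex.I * ((inner ℝ p.2 p.1 : ℝ) : ℂ))) *
        (χ p.2 : ℂ) :=
    ((Complex.continuous_conj.measurable.comp (hz.comp measurable_snd)).mul
      (by fun_prop)).mul (Complex.measurable_ofReal.comp (hχ.comp measurable_snd))
  exact hintegrand.stronglyMeasurable.integral_prod_right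

theorem norm_polaronPairing_le (χ : EuclideanSpace ℝ (Fin d) → ℝ) (z : PolaronSpace d)
    (x : EuclideanSpace ℝ (Fin d)) : ‖polaronPairing χ z x‖ ≤ ∫ k, ‖z k‖ * ‖χ k‖ := by
  refine (norm_integral_le_integral_norm _).trans_eq (integral_congr_ae (.of_forall fun k => ?_))
  simp [Complex.norm_exp]

theorem memLp_polaronPairing {χ : EuclideanSpace ℝ (Fin d) → ℝ} (hχ : Measurable χ)
    (z : PolaronSpace d) : MemLp (polaronPairing χ z) ⊤ volume :=
  memLp_top_of_bound (stronglyMeasurable_polaronPairing hχ z).aestronglyMeasurable _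
    (Eventually.of_forall (norm_polaronPairing_le χ z))

theorem memLp_polaronLowField (r : ℝ) (z : PolaronSpace d) :
    MemLp (polaronLowField r z) ⊤ volume :=
  (memLp_polaronPairing (measurable_polaronLow r) z).re.const_mul 2

theorem memLp_polaronHighField (r : ℝ) (z : PolaronSpace d) (i : Fin d) :
    MemLp (polaronHighField r z i) ⊤ volume :=
  ((memLp_polaronPairing (measurable_polaronHigh r i) z).const_mul Complex.I).re.const_mul 2

end Polaron

section Models

variable {N d : ℕ} {κ : Fin N → ℝ} {W : Cfg N d → ℝ}
  {𝔥 : Type*} [NormedAddCommGroup 𝔥] [InnerProductSpace ℂ 𝔥] [CompleteSpace 𝔥]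
  {ω : Dispersion 𝔥}

theorem isSelfAdjoint_ofReal_smul_one {E : Type*} [NormedAddCommGroup E] [InnerProductSpace ℂ E]
    [CompleteSpace E] (c : ℝ) : IsSelfAdjoint ((c : ℂ) • (1 : BOp E)) :=
  IsSelfAdjoint.smul (Complex.conj_ofReal c) (.one _)

/-- The sum `∑ⱼ b(xⱼ)` of one-particle multiplication operators. -/
def particleSumOp (N : ℕ) {b : EuclideanSpace ℝ (Fin d) → ℝ} (hb : MemLp b ⊤ volume) :
    BOp (L2 N d) :=
  ∑ j, mulOp (memLp_comp_pos hb j)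

theorem isSelfAdjoint_particleSumOp {b : EuclideanSpace ℝ (Fin d) → ℝ}
    (hb : MemLp b ⊤ volume) : IsSelfAdjoint (particleSumOp N hb) :=
  isSelfAdjoint_sum _ fun _ _ => isSelfAdjoint_mulOp _

theorem inner_particleSumOp {b : EuclideanSpace ℝ (Fin d) → ℝ} (hb : MemLp b ⊤ volume)
    (f g : L2 N d) :
    inner ℂ f (particleSumOp N hb g) = ∑ j, mulForm (fun x => (b (pos x j) : ℂ)) f g := by
  rw [particleSumOp, sum_apply, inner_sum]
  exact Finset.sum_congr rfl fun j _ => (mulForm_eq_inner_mulOp (memLp_comp_pos hb j) f g).symm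

theorem nelsonForm_eq_inner_firstOrderOp {lam : EuclideanSpace ℝ (Fin d) → 𝔥}
    (hlam : ω.IsFormFactor lam) (z : ω.FieldSpace) (u v : FormDomain κ W) :
    nelsonForm ω lam z u v = inner ℂ u (firstOrderOp κ W 0
      (particleSumOp N (ω.memLp_classicalField hlam z) + ((‖z‖ ^ 2 - 1 : ℝ) : ℂ) • 1) v) := by
  rw [inner_firstOrderOp, inner_formDomain, nelsonForm, add_apply, inner_add_right,
    inner_particleSumOp]
  simp only [Pi.zero_apply, zero_apply, inner_zero_left, inner_zero_right, add_zero,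
    Finset.sum_const_zero, smul_apply, one_apply_eq_self, inner_smul_right]
  push_cast
  ring

theorem minimizerEquivalence_nelson [TopologicalSpace.SeparableSpace 𝔥] (hW : ∀ x, 0 ≤ W x)
    (hWl : LocallyIntegrable W volume) {lam : EuclideanSpace ℝ (Fin d) → 𝔥}
    (hlam : ω.IsFormFactor lam) :
    MinimizerEquivalence (incl κ W) (nelsonForm ω lam) := by
  rw [funext fun z => funext₂ (nelsonForm_eq_inner_firstOrderOp (κ := κ) (W := W) hlam z)]
  exact minimizerEquivalence_firstOrder hW hWl 0 fun z =>
    (isSelfAdjoint_particleSumOp _).add (isSelfAdjoint_ofReal_smul_one _)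

/-- The coefficients `-√α 𝒱_>(xⱼ)` of the first-order part of the polaron form. -/
def polaronGradOp (N : ℕ) (α r : ℝ) (z : PolaronSpace d) (p : Fin N × Fin d) : BOp (L2 N d) :=
  ((-√α : ℝ) : ℂ) • mulOp (memLp_comp_pos (memLp_polaronHighField r z p.2) p.1)

theorem inner_polaronGradOp (α r : ℝ) (z : PolaronSpace d) (p : Fin N × Fin d) (f g : L2 N d) :
    inner ℂ f (polaronGradOp N α r z p g) =
      -((√α : ℝ) : ℂ) * mulForm (fun x => (polaronHighField r z p.2 (pos x p.1) : ℂ)) f g := by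
  rw [polaronGradOp, smul_apply, inner_smul_right, ← mulForm_eq_inner_mulOp, Complex.ofReal_neg]

theorem inner_polaronGradOp_left (α r : ℝ) (z : PolaronSpace d) (p : Fin N × Fin d)
    (f g : L2 N d) :
    inner ℂ (polaronGradOp N α r z p f) g =
      -((√α : ℝ) : ℂ) * mulForm (fun x => (polaronHighField r z p.2 (pos x p.1) : ℂ)) f g := by
  rw [polaronGradOp, smul_apply, inner_smul_left, inner_mulOp_left, ← mulForm_eq_inner_mulOp,
    Complex.conj_ofReal, Complex.ofReal_neg]

/-- The bounded zeroth-order part `√α ∑ⱼ 𝒱_<(xⱼ) + ‖z‖² - 1` of the polaron form, compared with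
`𝒦₀ + 1`. -/
def polaronStateOp (N : ℕ) (α r : ℝ) (z : PolaronSpace d) : BOp (L2 N d) :=
  ((√α : ℝ) : ℂ) • particleSumOp N (memLp_polaronLowField r z) + ((‖z‖ ^ 2 - 1 : ℝ) : ℂ) • 1

theorem isSelfAdjoint_polaronStateOp (α r : ℝ) (z : PolaronSpace d) :
    IsSelfAdjoint (polaronStateOp N α r z) :=
  (IsSelfAdjoint.smul (Complex.conj_ofReal _) (isSelfAdjoint_particleSumOp _)).add
    (isSelfAdjoint_ofReal_smul_one _)

theorem polaronForm_eq_inner_firstOrderOp (α r : ℝ) (z : PolaronSpace d)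
    (u v : FormDomain (fun _ => 1) W) :
    polaronForm α r z u v =
      inner ℂ u (firstOrderOp _ W (polaronGradOp N α r z) (polaronStateOp N α r z) v) := by
  rw [inner_firstOrderOp, inner_formDomain, polaronForm, polaronStateOp, Fintype.sum_prod_type]
  simp only [inner_polaronGradOp, inner_polaronGradOp_left, add_apply, smul_apply,
    one_apply_eq_self, inner_add_right, inner_smul_right, inner_particleSumOp,
    Finset.sum_sub_distrib, Finset.sum_add_distrib, ← Finset.mul_sum]
  push_cast
  ring

theorem minimizerEquivalence_polaron (hW : ∀ x, 0 ≤ W x) (hWl : LocallyIntegrable W volume)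
    (α r : ℝ) : MinimizerEquivalence (incl (fun _ => 1) W) (polaronForm α r) := by
  have : Fact ((2 : ℝ≥0∞) ≠ ∞) := ⟨ENNReal.ofNat_ne_top⟩
  have : SecondCountableTopology (PolaronSpace d) := Lp.SecondCountableTopology
  rw [funext fun z => funext₂ (polaronForm_eq_inner_firstOrderOp (W := W) α r z)]
  exact minimizerEquivalence_firstOrder hW hWl (polaronGradOp N α r)
    (isSelfAdjoint_polaronStateOp α r)

end Models

section PauliFierz

variable {N : ℕ} {κ : Fin N → ℝ} {W : Cfg N 3 → ℝ}
  {𝔥 : Type*} [NormedAddCommGroup 𝔥] [InnerProductSpace ℂ 𝔥] [CompleteSpace 𝔥]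
  {ω : Dispersion 𝔥} {lam : Fin N → Fin 3 → EuclideanSpace ℝ (Fin 3) → 𝔥}

/-- The component `√κⱼ e a_{z,j,i}(xⱼ)` of the vector potential as a bounded operator. -/
def potentialOp (κ : Fin N → ℝ) (hlam : ∀ j ℓ, ω.IsFormFactor (lam j ℓ)) (e : ℝ)
    (z : ω.FieldSpace) (p : Fin N × Fin 3) : BOp (L2 N 3) :=
  mulOp (memLp_comp_pos ((ω.memLp_classicalField (hlam p.1 p.2) z).const_mul (√(κ p.1) * e)) p.1)

theorem covDeriv_ae_eq (hlam : ∀ j ℓ, ω.IsFormFactor (lam j ℓ)) (e : ℝ) (z : ω.FieldSpace)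
    (u : FormDomain κ W) (p : Fin N × Fin 3) :
    covDeriv ω lam e z u p =ᵐ[volume]
      ((-Complex.I) • u.1 (.grad p) + potentialOp κ hlam e z p (u.1 .state) : L2 N 3) := by
  filter_upwards [mulOp_ae_eq _ (u.1 .state),
    Lp.coeFn_add ((-Complex.I) • u.1 (.grad p)) (potentialOp κ hlam e z p (u.1 .state)),
    Lp.coeFn_smul (-Complex.I) (u.1 (.grad p))] with x hmul hadd hsmul
  rw [hadd, Pi.add_apply, hsmul, Pi.smul_apply, potentialOp, hmul, smul_eq_mul, covDeriv]

theorem integral_covDeriv (hlam : ∀ j ℓ, ω.IsFormFactor (lam j ℓ)) (e : ℝ) (z : ω.FieldSpace)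
    (u v : FormDomain κ W) (p : Fin N × Fin 3) :
    ∫ x, starRingEnd ℂ (covDeriv ω lam e z u p x) * covDeriv ω lam e z v p x =
      inner ℂ ((-Complex.I) • u.1 (.grad p) + potentialOp κ hlam e z p (u.1 .state))
        ((-Complex.I) • v.1 (.grad p) + potentialOp κ hlam e z p (v.1 .state)) := by
  rw [L2.inner_def]
  refine integral_congr_ae ?_
  filter_upwards [covDeriv_ae_eq hlam e z u p, covDeriv_ae_eq hlam e z v p] with x hu hv
  rw [RCLike.inner_apply, hu, hv, mul_comm]

/-- The bounded zeroth-order part `∑ⱼ κⱼ e² |a_{z,j}(xⱼ)|² + ‖z‖² - 1` of the Pauli–Fierz form,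
compared with `𝒦₀ + 1`. -/
def pauliFierzStateOp (κ : Fin N → ℝ) (hlam : ∀ j ℓ, ω.IsFormFactor (lam j ℓ)) (e : ℝ)
    (z : ω.FieldSpace) : BOp (L2 N 3) :=
  ∑ p, potentialOp κ hlam e z p ^ 2 + ((‖z‖ ^ 2 - 1 : ℝ) : ℂ) • 1

theorem isSelfAdjoint_pauliFierzStateOp (hlam : ∀ j ℓ, ω.IsFormFactor (lam j ℓ)) (e : ℝ)
    (z : ω.FieldSpace) : IsSelfAdjoint (pauliFierzStateOp κ hlam e z) :=
  (isSelfAdjoint_sum _ fun _ _ => (isSelfAdjoint_mulOp _).pow 2).add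
    (isSelfAdjoint_ofReal_smul_one _)

theorem pauliFierzForm_eq_inner_firstOrderOp (hlam : ∀ j ℓ, ω.IsFormFactor (lam j ℓ)) (e : ℝ)
    (z : ω.FieldSpace) (u v : FormDomain κ W) :
    pauliFierzForm ω lam e z u v =
      inner ℂ u (firstOrderOp κ W (fun p => Complex.I • potentialOp κ hlam e z p)
        (pauliFierzStateOp κ hlam e z) v) := by
  have hsymm (p : Fin N × Fin 3) (f g : L2 N 3) :
      inner ℂ (potentialOp κ hlam e z p f) g = inner ℂ f (potentialOp κ hlam e z p g) :=
    inner_mulOp_left _ f g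
  rw [inner_firstOrderOp, inner_formDomain, pauliFierzForm, freeForm, pauliFierzStateOp]
  simp only [integral_covDeriv hlam, add_apply, sum_apply, smul_apply, one_apply_eq_self, sq,
    mul_apply_eq_comp, inner_add_right, inner_add_left, inner_sum, inner_smul_right,
    inner_smul_left, hsymm, map_neg, Complex.conj_I, Finset.sum_add_distrib, ← Finset.mul_sum]
  push_cast
  linear_combination
    (-∑ p, inner ℂ (u.1 (.grad p)) (v.1 (.grad p))) * Complex.I_mul_I

theorem minimizerEquivalence_pauliFierz [TopologicalSpace.SeparableSpace 𝔥]
    (hW : ∀ x, 0 ≤ W x) (hWl : LocallyIntegrable W volume)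
    (hlam : ∀ j ℓ, ω.IsFormFactor (lam j ℓ)) (e : ℝ) :
    MinimizerEquivalence (incl κ W) (pauliFierzForm ω lam e) := by
  rw [funext fun z => funext₂ (pauliFierzForm_eq_inner_firstOrderOp (κ := κ) (W := W) hlam e z)]
  exact minimizerEquivalence_firstOrder hW hWl _ (isSelfAdjoint_pauliFierzStateOp hlam e)

theorem massCoeff_nonneg {m : Fin N → ℝ} (hm : ∀ j, 0 < m j) (j : Fin N) : 0 ≤ massCoeff m j :=
  div_nonneg zero_le_one (mul_nonneg zero_le_two (hm j).le)

end PauliFierz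

end QuasiClassical

end

theorem mainTheorem12_general (N : ℕ) :
    (∀ (d : ℕ) (κ : Fin N → ℝ) (_ : ∀ j, 0 ≤ κ j)
      (W : QuasiClassical.Cfg N d → ℝ) (_ : ∀ x, 0 ≤ W x)
      (_ : MeasureTheory.LocallyIntegrable W MeasureTheory.volume)
      (𝔥 : Type*) [NormedAddCommGroup 𝔥] [InnerProductSpace ℂ 𝔥] [CompleteSpace 𝔥]
      [TopologicalSpace.SeparableSpace 𝔥] (ω : QuasiClassical.Dispersion 𝔥)
      (lam : EuclideanSpace ℝ (Fin d) → 𝔥) (_ : ω.IsFormFactor lam),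
      QuasiClassical.MinimizerEquivalence (QuasiClassical.incl κ W)
        (QuasiClassical.nelsonForm ω lam)) ∧
    (∀ (d : ℕ) (W : QuasiClassical.Cfg N d → ℝ) (_ : ∀ x, 0 ≤ W x)
      (_ : MeasureTheory.LocallyIntegrable W MeasureTheory.volume)
      (α : ℝ) (_ : 0 ≤ α) (r : ℝ) (_ : 0 < r),
      QuasiClassical.MinimizerEquivalence (QuasiClassical.incl (fun _ => 1) W)
        (QuasiClassical.polaronForm α r)) ∧
    (∀ (κ : Fin N → ℝ) (_ : ∀ j, 0 ≤ κ j) (W : QuasiClassical.Cfg N 3 → ℝ) (_ : ∀ x, 0 ≤ W x)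
      (_ : MeasureTheory.LocallyIntegrable W MeasureTheory.volume)
      (𝔥 : Type*) [NormedAddCommGroup 𝔥] [InnerProductSpace ℂ 𝔥] [CompleteSpace 𝔥]
      [TopologicalSpace.SeparableSpace 𝔥] (ω : QuasiClassical.Dispersion 𝔥) (e : ℝ)
      (lam : Fin N → Fin 3 → EuclideanSpace ℝ (Fin 3) → 𝔥)
      (_ : ∀ j ℓ, ω.IsFormFactor (lam j ℓ)),
      QuasiClassical.MinimizerEquivalence (QuasiClassical.incl κ W)
        (QuasiClassical.pauliFierzForm ω lam e)) :=
  ⟨fun _ _ _ _ hW hWl _ _ _ _ _ _ _ hlam =>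
      QuasiClassical.minimizerEquivalence_nelson hW hWl hlam,
    fun _ _ hW hWl α _ r _ => QuasiClassical.minimizerEquivalence_polaron hW hWl α r,
    fun _ _ _ hW hWl _ _ _ _ _ _ e _ hlam =>
      QuasiClassical.minimizerEquivalence_pauliFierz hW hWl hlam e⟩

theorem mainTheorem12 (N : ℕ) :
    -- Nelson model
    (∀ (d : ℕ) (_ : 1 ≤ d ∧ d ≤ 3)
      (W : QuasiClassical.Cfg N d → ℝ) (_ : ∀ x, 0 ≤ W x)
      (_ : MeasureTheory.LocallyIntegrable W MeasureTheory.volume)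
      (𝔥 : Type*) [NormedAddCommGroup 𝔥] [InnerProductSpace ℂ 𝔥] [CompleteSpace 𝔥]
      [TopologicalSpace.SeparableSpace 𝔥] (ω : QuasiClassical.Dispersion 𝔥)
      (lam : EuclideanSpace ℝ (Fin d) → 𝔥) (_ : ω.IsFormFactor lam),
      QuasiClassical.MinimizerEquivalence (QuasiClassical.incl (fun _ => 1) W)
        (QuasiClassical.nelsonForm ω lam)) ∧
    -- Fröhlich polaron
    (∀ (d : ℕ) (_ : 1 ≤ d ∧ d ≤ 3)
      (W : QuasiClassical.Cfg N d → ℝ) (_ : ∀ x, 0 ≤ W x)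
      (_ : MeasureTheory.LocallyIntegrable W MeasureTheory.volume)
      (α : ℝ) (_ : 0 < α) (r : ℝ) (_ : 0 < r),
      QuasiClassical.MinimizerEquivalence (QuasiClassical.incl (fun _ => 1) W)
        (QuasiClassical.polaronForm α r)) ∧
    -- Pauli-Fierz model
    (∀ (W : QuasiClassical.Cfg N 3 → ℝ) (_ : ∀ x, 0 ≤ W x)
      (_ : MeasureTheory.LocallyIntegrable W MeasureTheory.volume)
      (𝔥 : Type*) [NormedAddCommGroup 𝔥] [InnerProductSpace ℂ 𝔥] [CompleteSpace 𝔥]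
      [TopologicalSpace.SeparableSpace 𝔥] (ω : QuasiClassical.Dispersion 𝔥)
      (m : Fin N → ℝ) (_ : ∀ j, 0 < m j) (e : ℝ)
      (lam : Fin N → Fin 3 → EuclideanSpace ℝ (Fin 3) → 𝔥)
      (_ : ∀ j ℓ, ω.IsFormFactor (lam j ℓ)),
      QuasiClassical.MinimizerEquivalence
        (QuasiClassical.incl (QuasiClassical.massCoeff m) W)
        (QuasiClassical.pauliFierzForm ω lam e)) :=
  have ⟨nelson, polaron, pauliFierz⟩ := mainTheorem12_general N
  ⟨fun d _ => nelson d _ fun _ => zero_le_one,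
    fun d _ W hW hWl α hα => polaron d W hW hWl α hα.le,
    fun W hW hWl 𝔥 _ _ _ _ ω _ hm =>
      pauliFierz _ (QuasiClassical.massCoeff_nonneg hm) W hW hWl 𝔥 ω⟩
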